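/- Let $d\ge 1$, let $f\in C^1(\mathbb R;\mathbb R^d)$, and let $\Omega\subset\mathbb R^d$ be an open set (bounded or not) with $C^2$ boundary, lying locally on one side of its boundary; denote by $\eta$ its outer unit normal and by $\sigma$ the surface measure on $\partial\Omega$. For $x\in\partial\Omega$ and $k,\alpha\in\mathbb R$ put $$\omega^+(x,k,\alpha)=\max_{k\le r,s\le \max(\alpha,k)}|\langle f(r)-f(s),\eta(x)\rangle|,\qquad \omega^-(x,k,\alpha)=\max_{\min(\alpha,k)\le r,s\le k}|\langle f(r)-f(s),\eta(x)\rangle| .$$ For $u_0\in L^\infty(\Omega)$ and $u_b\in L^\infty((0,\infty)\times\partial\Omega)$, a function $u\in L^\infty((0,\infty)\times\Omega)$ is called an entropy solution of $$\partial_t u+\operatorname{div} f(u)=0 \ \text{ in } (0,\infty)\times\Omega,\qquad u=u_b \ \text{ on } (0,\infty)\times\partial\Omega,\qquad u(0,\cdot)=u_0 \ \text{ on } \Omega$$ if for every $k\in\mathbb R$ and every nonnegative $\zeta\in C_c^\infty([0,\infty)\times\mathbb R^d)$ $$\int_0^\infty\!\!\int_\Omega \big[(u-k)^+\partial_t\zeta+\chi_{\{u>k\}}\langle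 f(u)-f(k),\nabla\zeta\rangle\big]\,dx\,dt+\int_{\partial\Omega}\int_0^\infty \zeta\,\omega^+(x,k,u_b)\,dt\,d\sigma+\int_\Omega (u_0-k)^+\zeta(0,x)\,dx\ge 0,$$ $$\int_0^\infty\!\!\int_\Omega \big[(k-u)^+\partial_t\zeta+\chi_{\{u<k\}}\langle f(k)-f(u),\nabla\zeta\rangle\big]\,dx\,dt+\int_{\partial\Omega}\int_0^\infty \zeta\,\omega^-(x,k,u_b)\,dt\,d\sigma+\int_\Omega (k-u_0)^+\zeta(0,x)\,dx\ge 0.$$ Let $I\subset\mathbb R$ be an interval such that $(f,\Omega,I)$ satisfies the replacement condition in time $\mathfrak t>0$ with direction $w\in\mathbb R^d$ and constant $c>0$, that is, $$L:=\sup_{x\in\Omega}\langle w,x\rangle-\inf_{x\in\Omega}\langle w,x\rangle<+\infty,\qquad \langle f'(s),w\rangle\ge c\ \text{ for all } s\in I,\qquad \mathfrak t=\frac Lc .$$ Let $u_0,v_0\in L^\infty(\Omega)$ and $u_b\in L^\infty((0,\infty)\times\partial\Omega)$ take values in $I$ almost everywhere, and let $u$ and $v$ be entropy solutions of the above problem with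 initial data $u_0$ and $v_0$ respectively and with the same boundary datum $u_b$. Then $$u(t,x)=v(t,x)\qquad\text{for almost every } t\ge \mathfrak t \text{ and almost every } x\in\Omega,$$ and, if $u$ and $v$ are represented by functions in $C^0((0,\infty);L^1_{\rm loc}(\Omega))$, so that their values at each time are defined, then for every $t\ge\mathfrak t$ one has $u(t,x)=v(t,x)$ for almost every $x\in\Omega$. -/

import Mathlib

open MeasureTheory Set Filter
open scoped Topology ContDiff

/-- The space variable lives in `ℝ^d` with its Euclidean norm. -/
abbrev Space (d : ℕ) : Type := EuclideanSpace ℝ (Fin d)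

/-- `ρ` is a `C²` defining function of `Ω` near the boundary point `x`: it is `C²` near `x`, its
gradient does not vanish at `x`, and near `x` the set `Ω` is `{ρ < 0}` (so that `Ω` lies locally on
one side of its boundary). -/
def IsC2DefiningFunctionAt {d : ℕ} (Ω : Set (Space d)) (x : Space d) (ρ : Space d → ℝ) : Prop :=
  ContDiffAt ℝ 2 ρ x ∧ gradient ρ x ≠ 0 ∧ ∀ᶠ y in 𝓝 x, (y ∈ Ω ↔ ρ y < 0)

/-- Open sets of `ℝ^d`, bounded or not, with a boundary of class `C²`. -/
def IsC2Domain {d : ℕ} (Ω : Set (Space d)) : Prop :=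
  IsOpen Ω ∧ ∀ x ∈ frontier Ω, ∃ ρ : Space d → ℝ, IsC2DefiningFunctionAt Ω x ρ

open Classical in
/-- The outer unit normal `η(x)` at a boundary point: the normalized gradient of a defining function
(the value does not depend on which defining function is chosen). -/
noncomputable def outerUnitNormal {d : ℕ} (Ω : Set (Space d)) (x : Space d) : Space d :=
  if h : ∃ ρ : Space d → ℝ, IsC2DefiningFunctionAt Ω x ρ then
    ‖gradient h.choose x‖⁻¹ • gradient h.choose x
  else 0

/-- Lebesgue measure on `(0,∞) × Ω`. -/
noncomputable def cylinderMeasure {d : ℕ} (Ω : Set (Space d)) : Measure (ℝ × Space d) :=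
  volume.restrict (Ioi 0 ×ˢ Ω)

/-- The surface measure `σ` on `∂Ω`: the `(d-1)`-dimensional Hausdorff measure, normalized so as to
agree with Lebesgue measure on hyperplanes (counting measure when `d = 1`). -/
noncomputable def surfaceMeasure {d : ℕ} (Ω : Set (Space d)) : Measure (Space d) :=
  (Measure.euclideanHausdorffMeasure (d - 1)).restrict (frontier Ω)

/-- The measure `dt ⊗ dσ` on the lateral boundary `(0,∞) × ∂Ω`. -/
noncomputable def lateralMeasure {d : ℕ} (Ω : Set (Space d)) : Measure (ℝ × Space d) :=
  (volume.restrict (Ioi 0)).prod (surfaceMeasure Ω)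

/-- `ω⁺(x,k,α) = max_{k ≤ r,s ≤ max(α,k)} |⟨f(r) - f(s), η(x)⟩|`. -/
noncomputable def omegaPlus {d : ℕ} (f : ℝ → Space d) (Ω : Set (Space d))
    (x : Space d) (k α : ℝ) : ℝ :=
  sSup ((fun p : ℝ × ℝ => |inner ℝ (f p.1 - f p.2) (outerUnitNormal Ω x)|) ''
    (Icc k (max α k) ×ˢ Icc k (max α k)))

/-- `ω⁻(x,k,α) = max_{min(α,k) ≤ r,s ≤ k} |⟨f(r) - f(s), η(x)⟩|`. -/
noncomputable def omegaMinus {d : ℕ} (f : ℝ → Space d) (Ω : Set (Space d))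
    (x : Space d) (k α : ℝ) : ℝ :=
  sSup ((fun p : ℝ × ℝ => |inner ℝ (f p.1 - f p.2) (outerUnitNormal Ω x)|) ''
    (Icc (min α k) k ×ˢ Icc (min α k) k))

/-- The nonnegative test functions in `C_c^∞([0,∞) × ℝ^d)`, i.e. the restrictions to `t ≥ 0` of
smooth compactly supported functions on `ℝ × ℝ^d`. They need not vanish at `t = 0` or on `∂Ω`. -/
def IsTestFunction {d : ℕ} (ζ : ℝ × Space d → ℝ) : Prop :=
  ContDiff ℝ ∞ ζ ∧ HasCompactSupport ζ ∧ ∀ t : ℝ, 0 ≤ t → ∀ x : Space d, 0 ≤ ζ (t, x)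

/-- The time derivative `∂_t ζ`. -/
noncomputable def timeDeriv {d : ℕ} (ζ : ℝ × Space d → ℝ) (p : ℝ × Space d) : ℝ :=
  deriv (fun s : ℝ => ζ (s, p.2)) p.1

/-- The gradient `∇ζ` in the space variable. -/
noncomputable def spaceGradient {d : ℕ} (ζ : ℝ × Space d → ℝ) (p : ℝ × Space d) : Space d :=
  gradient (fun y : Space d => ζ (p.1, y)) p.2

/-- `u ∈ L^∞((0,∞) × Ω)` is an entropy solution of `∂_t u + div f(u) = 0` in `(0,∞) × Ω` with
boundary datum `ub` on `(0,∞) × ∂Ω` and initial datum `u₀` on `Ω`: both families of semi-Kruzhkov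
entropy inequalities hold up to the boundary. -/
structure IsEntropySolution {d : ℕ} (f : ℝ → Space d) (Ω : Set (Space d))
    (u₀ : Space d → ℝ) (ub : ℝ → Space d → ℝ) (u : ℝ → Space d → ℝ) : Prop where
  memLp : MemLp (fun p : ℝ × Space d => u p.1 p.2) ⊤ (cylinderMeasure Ω)
  entropy_plus : ∀ (k : ℝ) (ζ : ℝ × Space d → ℝ), IsTestFunction ζ →
    0 ≤ (∫ p, (max (u p.1 p.2 - k) 0 * timeDeriv ζ p
            + (if k < u p.1 p.2 then
                inner ℝ (f (u p.1 p.2) - f k) (spaceGradient ζ p) else 0)) ∂(cylinderMeasure Ω))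
      + (∫ p, ζ p * omegaPlus f Ω p.2 k (ub p.1 p.2) ∂(lateralMeasure Ω))
      + ∫ x in Ω, max (u₀ x - k) 0 * ζ (0, x)
  entropy_minus : ∀ (k : ℝ) (ζ : ℝ × Space d → ℝ), IsTestFunction ζ →
    0 ≤ (∫ p, (max (k - u p.1 p.2) 0 * timeDeriv ζ p
            + (if u p.1 p.2 < k then
                inner ℝ (f k - f (u p.1 p.2)) (spaceGradient ζ p) else 0)) ∂(cylinderMeasure Ω))
      + (∫ p, ζ p * omegaMinus f Ω p.2 k (ub p.1 p.2) ∂(lateralMeasure Ω))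
      + ∫ x in Ω, max (k - u₀ x) 0 * ζ (0, x)

/-- The replacement condition for `(f, Ω, I)` with direction `w`, constant `c` and time `𝔱`:
`L = sup_Ω ⟨w,x⟩ - inf_Ω ⟨w,x⟩ < ∞`, `⟨f'(s), w⟩ ≥ c > 0` for `s ∈ I`, and `𝔱 = L / c > 0`. -/
structure ReplacementCondition {d : ℕ} (f : ℝ → Space d) (Ω : Set (Space d)) (I : Set ℝ)
    (w : Space d) (c 𝔱 : ℝ) : Prop where
  c_pos : 0 < c
  time_pos : 0 < 𝔱
  bddAbove : BddAbove ((fun x : Space d => (inner ℝ w x : ℝ)) '' Ω)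
  bddBelow : BddBelow ((fun x : Space d => (inner ℝ w x : ℝ)) '' Ω)
  speed : ∀ s ∈ I, c ≤ inner ℝ (deriv f s) w
  time_eq : 𝔱 = (sSup ((fun x : Space d => (inner ℝ w x : ℝ)) '' Ω)
    - sInf ((fun x : Space d => (inner ℝ w x : ℝ)) '' Ω)) / c

/-- `u ∈ C⁰((0,∞); L¹_loc(Ω))`. -/
def ContinuousInL1loc {d : ℕ} (Ω : Set (Space d)) (u : ℝ → Space d → ℝ) : Prop :=
  ∀ t : ℝ, 0 < t → ∀ K : Set (Space d), IsCompact K → K ⊆ Ω →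
    IntegrableOn (u t) K ∧
      Tendsto (fun s : ℝ => ∫⁻ x in K, ‖u s x - u t x‖ₑ) (𝓝 t) (𝓝 0)

set_option linter.unusedSectionVars false

/-! Write `G(s) = (s, f(s))` and let `V = fluxJump G u v = ((u - v)⁺, χ_{u>v}(f(u) - f(v)))`. The
proof rests on Kato's inequality `div_{t,x} V ≤ 0`, valid weakly up to `∂Ω` for test functions
vanishing near `t = 0`, because `u` and `v` share their boundary datum (`IsEntropySolution.kato`).

By the maximum principle, `u` and `v` lie between `inf I` and `sup I`, so the speed condition gives
`⟨w, V_x⟩ ≥ c V_t`: the difference of the solutions is carried along `w` at speed at least `c`. A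
weight that increases with `ct - ⟨w,x⟩` therefore decreases along `V`. With `m = inf_Ω ⟨w,x⟩`, it
can be chosen to vanish on `Ω` for small times and to be positive at any given point of `{⟨w,x⟩ - m
< ct}`. Multiplied by a cutoff supported in a backward cone and strictly decreasing along `V ≠ 0`,
it forces `V_t = 0` there (`ae_eq_zero_of_weak_inequality`, `IsEntropySolution.ae_le_of_swept`). For
`t > 𝔱` that region contains all of `Ω`. Exchanging `u` and `v` gives equality.

Kato's inequality is obtained without boundary traces. The interior cone property provides kernels
that push points of `closure Ω` into `Ω`, so in the doubling of variables one solution is tested up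
to the boundary and the other only inside. Near a boundary point fix a constant `k` close to the
datum. Then `u` at levels above `k` and `v` at levels below `k` have boundary terms at most `C |u_b
- k|`, and the jump between `u` and `v` splits into a part above `k` and a part below `k`. Each
doubling leaves a jump between one solution and `k`, tested against a mollified function supported
in `Q = (0,∞) × Ω`. The corresponding entropy defect has finite mass up to the boundary, hence is
small off a compact subset of `Q` (`exists_compact_small_defect`); near that compact set the
interior inequalities suffice (`kato_of_kernel`). Finally, a partition of unity lets `k` follow a
continuous `L¹` approximation of `u_b` (`kato_inequality`). -/

/-- The jump `G(a ∨ b) - G(b)` of the space-time flux `G` in a semi-Kruzhkov entropy inequality. -/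
def fluxJump {E : Type*} [AddCommGroup E] (G : ℝ → E) (a b : ℝ) : E := G (max a b) - G b

/-- Nonnegative smooth functions with compact support. -/
structure IsBumpFunction {E : Type*} [NormedAddCommGroup E] [NormedSpace ℝ E] (φ : E → ℝ) :
    Prop where
  contDiff : ContDiff ℝ ∞ φ
  hasCompactSupport : HasCompactSupport φ
  nonneg : ∀ z, 0 ≤ φ z

/-! ### Algebra and Lipschitz bounds of the flux jump -/

section FluxJump

variable {E : Type*} [NormedAddCommGroup E] {G : ℝ → E}

theorem fluxJump_of_le {a b : ℝ} (h : a ≤ b) : fluxJump G a b = 0 := by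
  simp [fluxJump, max_eq_right h]

/-- Used with `a = u`, `b = v`: it turns the inequality for `v` at level `max u k` into the
comparison of `u` with `max v k`, plus a remainder free of `u`. -/
theorem fluxJump_sup_add (a b k : ℝ) :
    fluxJump G a (max b k) + fluxJump G k b = fluxJump G (max a k) b := by
  simp only [fluxJump]
  rw [show max a (max b k) = max (max a k) b by rw [max_assoc, max_comm b k], max_comm b k]
  abel

/-- The jump is cut at level `k`: the first term sees only values above `k`, the second only values
below. -/
theorem fluxJump_sup_add_inf (a b k : ℝ) :
    fluxJump G a (max b k) + fluxJump G (min a k) b = fluxJump G a b := by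
  simp only [fluxJump]
  rcases le_total a k with h | h
  · rw [min_eq_left h, max_eq_right (h.trans (le_max_right b k))]
    abel
  · rw [min_eq_right h, max_comm b k, ← max_assoc, max_eq_left h]
    abel

/-- The symmetry `(u, v, G) ↦ (-v, -u, -G(-·))` of the flux jump. -/
theorem fluxJump_neg (a b : ℝ) :
    fluxJump (fun s => -G (-s)) (-b) (-a) = fluxJump G a b := by
  simp only [fluxJump, max_neg_neg, neg_neg]
  rcases le_total a b with h | h
  · simp [h]
  · simp [h]; abel

theorem fluxJump_neg' (a b : ℝ) :
    fluxJump (fun s => -G (-s)) a b = fluxJump G (-b) (-a) := by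
  rw [← fluxJump_neg (G := G) (-b) (-a), neg_neg, neg_neg]

theorem norm_fluxJump_sub_le {C : NNReal} {S : Set ℝ} (hG : LipschitzOnWith C G S) {a b b' : ℝ}
    (ha : a ∈ S) (hb : b ∈ S) (hb' : b' ∈ S) :
    ‖fluxJump G a b - fluxJump G a b'‖ ≤ 2 * C * |b - b'| := by
  have hS : ∀ x y, x ∈ S → y ∈ S → max x y ∈ S := by
    intro x y hx hy
    rcases le_total x y with h | h <;> simp [h, hx, hy]
  have h1 := hG.norm_sub_le (hS a b ha hb) (hS a b' ha hb')
  have h2 := hG.norm_sub_le hb hb'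
  have h3 : ‖max a b - max a b'‖ ≤ |b - b'| := by
    rw [Real.norm_eq_abs, max_comm a b, max_comm a b']; exact abs_max_sub_max_le_abs b b' a
  have h4 : (C : ℝ) * ‖max a b - max a b'‖ ≤ C * |b - b'| := by gcongr
  rw [Real.norm_eq_abs] at h2
  calc ‖fluxJump G a b - fluxJump G a b'‖
      = ‖(G (max a b) - G (max a b')) - (G b - G b')‖ := by simp only [fluxJump]; congr 1; abel
    _ ≤ ‖G (max a b) - G (max a b')‖ + ‖G b - G b'‖ := norm_sub_le _ _
    _ ≤ 2 * C * |b - b'| := by linarith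

theorem norm_fluxJump_le {C : NNReal} {S : Set ℝ} (hG : LipschitzOnWith C G S) {a b : ℝ}
    (ha : a ∈ S) (hb : b ∈ S) : ‖fluxJump G a b‖ ≤ 2 * C * |b - a| := by
  simpa [fluxJump_of_le (G := G) (le_refl a)] using norm_fluxJump_sub_le hG ha hb ha

theorem continuous_fluxJump (hG : Continuous G) :
    Continuous fun p : ℝ × ℝ => fluxJump G p.1 p.2 := by
  unfold fluxJump
  fun_prop

end FluxJump

/-! ### Continuity of translations in the mean -/

section Translation

variable {E : Type*} [NormedAddCommGroup E] [NormedSpace ℝ E] [FiniteDimensional ℝ E]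
  [MeasurableSpace E] [BorelSpace E] {μ : Measure E} [μ.IsAddHaarMeasure]

/-- Continuity of translations in `L¹`. -/
theorem tendsto_integral_norm_translate_sub {g : E → ℝ} (hg : Integrable g μ) :
    Tendsto (fun h : E => ∫ z, |g (z + h) - g z| ∂μ) (𝓝 0) (𝓝 0) := by
  have key : ∀ ε > 0, ∀ᶠ h in 𝓝 (0 : E), ∫ z, |g (z + h) - g z| ∂μ ≤ ε := by
    intro ε hε
    obtain ⟨φ, hφc, hφ, hφcont, hφint⟩ :=
      hg.exists_hasCompactSupport_integral_sub_le (show 0 < ε / 3 by positivity)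
    have hcont : Tendsto (fun h : E => ∫ z, |φ (z + h) - φ z| ∂μ) (𝓝 0) (𝓝 0) := by
      obtain ⟨B, hB⟩ := hφcont.bounded_above_of_compact_support hφc
      set K := Metric.cthickening 1 (tsupport φ) with hK
      have hKc : IsCompact K := hφc.isCompact.cthickening
      have : Tendsto (fun h : E => ∫ z, |φ (z + h) - φ z| ∂μ) (𝓝 0)
          (𝓝 (∫ z, |φ (z + 0) - φ z| ∂μ)) := by
        refine tendsto_integral_filter_of_dominated_convergence
          (K.indicator fun _ => 2 * B) ?_ ?_ ?_ ?_
        · exact Eventually.of_forall fun h => by fun_prop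
        · filter_upwards [Metric.closedBall_mem_nhds (0 : E) one_pos] with h hh
          refine Eventually.of_forall fun z => ?_
          by_cases hz : z ∈ K
          · rw [indicator_of_mem hz]
            have h1 := hB (z + h)
            have h2 := hB z
            rw [Real.norm_eq_abs, abs_abs]
            rw [Real.norm_eq_abs] at h1 h2
            calc |φ (z + h) - φ z| ≤ |φ (z + h)| + |φ z| := abs_sub _ _
              _ ≤ 2 * B := by linarith
          · have h1 : φ z = 0 := by
              by_contra hne
              exact hz (Metric.self_subset_cthickening _ (subset_tsupport _ hne))
            have h2 : φ (z + h) = 0 := by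
              by_contra hne
              refine hz (Metric.mem_cthickening_of_dist_le z (z + h) 1 _
                (subset_tsupport _ hne) ?_)
              rw [dist_eq_norm]
              simpa using hh
            simp [h1, h2, hz]
        · rw [integrable_indicator_iff hKc.measurableSet]
          exact integrableOn_const hKc.measure_lt_top.ne
        · refine Eventually.of_forall fun z => ?_
          have : Continuous fun h : E => |φ (z + h) - φ z| := by fun_prop
          exact this.tendsto 0
      simpa using this
    filter_upwards [hcont.eventually_le_const (show 0 < ε / 3 by positivity)] with h hh
    have hgh : Integrable (fun z => g (z + h)) μ := hg.comp_add_right h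
    have hφh : Integrable (fun z => φ (z + h)) μ := hφint.comp_add_right h
    have e1 : ∫ z, ‖g (z + h) - φ (z + h)‖ ∂μ = ∫ z, ‖g z - φ z‖ ∂μ :=
      integral_add_right_eq_self (fun z => ‖g z - φ z‖) h
    calc ∫ z, |g (z + h) - g z| ∂μ
        ≤ ∫ z, (‖g (z + h) - φ (z + h)‖ + |φ (z + h) - φ z| + ‖g z - φ z‖) ∂μ := by
          refine integral_mono (hgh.sub hg).abs
            (((hgh.sub hφh).norm.add (hφh.sub hφint).abs).add (hg.sub hφint).norm) fun z => ?_
          simp only [Real.norm_eq_abs]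
          have h1 := abs_add_le (g (z + h) - φ (z + h) + (φ (z + h) - φ z)) (φ z - g z)
          have h2 := abs_add_le (g (z + h) - φ (z + h)) (φ (z + h) - φ z)
          rw [abs_sub_comm (φ z)] at h1
          have : g (z + h) - g z = g (z + h) - φ (z + h) + (φ (z + h) - φ z) + (φ z - g z) := by
            ring
          rw [this]
          linarith
      _ = ∫ z, ‖g (z + h) - φ (z + h)‖ ∂μ + ∫ z, |φ (z + h) - φ z| ∂μ
            + ∫ z, ‖g z - φ z‖ ∂μ := by
          have i1 : Integrable (fun z => ‖g (z + h) - φ (z + h)‖) μ := (hgh.sub hφh).norm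
          have i2 : Integrable (fun z => |φ (z + h) - φ z|) μ := (hφh.sub hφint).abs
          have i3 : Integrable (fun z => ‖g z - φ z‖) μ := (hg.sub hφint).norm
          have i4 : Integrable (fun z => ‖g (z + h) - φ (z + h)‖ + |φ (z + h) - φ z|) μ := i1.add i2
          rw [integral_add i4 i3, integral_add i1 i2]
      _ ≤ ε := by rw [e1]; linarith
  refine (tendsto_order.2 ⟨fun a ha => Eventually.of_forall fun h =>
    ha.trans_le (integral_nonneg fun z => abs_nonneg _), fun a ha => ?_⟩)
  filter_upwards [key (a / 2) (by positivity)] with h hh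
  linarith

/-- Continuity of translations, on compact sets, for bounded measurable functions. -/
theorem tendsto_setIntegral_norm_translate_sub {v : E → ℝ} (hv : Measurable v) {M : ℝ}
    (hvM : ∀ z, |v z| ≤ M) {K : Set E} (hK : IsCompact K) :
    Tendsto (fun h : E => ∫ z in K, |v (z + h) - v z| ∂μ) (𝓝 0) (𝓝 0) := by
  -- `K'` contains every translate of `K` by `‖h‖ ≤ 1`, so truncating `v` outside `K'` makes it
  -- integrable without changing the integral over `K`.
  set K' := Metric.cthickening 1 K
  have hK' : IsCompact K' := hK.cthickening
  have hint : Integrable (K'.indicator v) μ := by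
    rw [integrable_indicator_iff hK'.measurableSet]
    exact Measure.integrableOn_of_bounded (M := M) hK'.measure_lt_top.ne hv.aestronglyMeasurable
      (Eventually.of_forall fun z => hvM z)
  refine squeeze_zero' (Eventually.of_forall fun h => integral_nonneg fun z => abs_nonneg _) ?_
    (tendsto_integral_norm_translate_sub hint)
  filter_upwards [Metric.closedBall_mem_nhds (0 : E) one_pos] with h hh
  have hint' : Integrable (fun z => K'.indicator v (z + h)) μ := hint.comp_add_right h
  calc ∫ z in K, |v (z + h) - v z| ∂μ
      = ∫ z in K, |K'.indicator v (z + h) - K'.indicator v z| ∂μ := by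
        refine setIntegral_congr_fun hK.measurableSet fun z hz => ?_
        have h1 : z ∈ K' := Metric.self_subset_cthickening _ hz
        have h2 : z + h ∈ K' := by
          refine Metric.mem_cthickening_of_dist_le (z + h) z 1 _ hz ?_
          rw [dist_eq_norm]
          simpa using hh
        simp only [indicator_of_mem h1, indicator_of_mem h2]
    _ ≤ ∫ z, |K'.indicator v (z + h) - K'.indicator v z| ∂μ :=
        setIntegral_le_integral (hint'.sub hint).abs (Eventually.of_forall fun z => abs_nonneg _)

end Translation

/-! ### Bump functions and cutoffs -/

section Bump

variable {E : Type*} [NormedAddCommGroup E] [NormedSpace ℝ E]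

theorem IsBumpFunction.continuous_fderiv {φ : E → ℝ} (hφ : IsBumpFunction φ) :
    Continuous (fderiv ℝ φ) :=
  hφ.contDiff.continuous_fderiv (by simp)

theorem IsBumpFunction.differentiable {φ : E → ℝ} (hφ : IsBumpFunction φ) :
    Differentiable ℝ φ :=
  hφ.contDiff.differentiable (by simp)

theorem IsBumpFunction.add {φ ψ : E → ℝ} (hφ : IsBumpFunction φ) (hψ : IsBumpFunction ψ) :
    IsBumpFunction (fun z => φ z + ψ z) :=
  ⟨hφ.contDiff.add hψ.contDiff, hφ.hasCompactSupport.add hψ.hasCompactSupport,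
    fun z => add_nonneg (hφ.nonneg z) (hψ.nonneg z)⟩

theorem IsBumpFunction.mul {φ ψ : E → ℝ} (hφ : IsBumpFunction φ) (hψ : ContDiff ℝ ∞ ψ)
    (hψ0 : ∀ z, 0 ≤ ψ z) : IsBumpFunction (fun z => φ z * ψ z) :=
  ⟨hφ.contDiff.mul hψ, hφ.hasCompactSupport.mul_right,
    fun z => mul_nonneg (hφ.nonneg z) (hψ0 z)⟩

theorem tsupport_mul_subset_left' {X : Type*} [TopologicalSpace X] (φ ψ : X → ℝ) :
    tsupport (fun z => φ z * ψ z) ⊆ tsupport φ :=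
  closure_mono fun _ hz => left_ne_zero_of_mul hz

theorem tsupport_mul_subset_right' {X : Type*} [TopologicalSpace X] (φ ψ : X → ℝ) :
    tsupport (fun z => φ z * ψ z) ⊆ tsupport ψ :=
  closure_mono fun _ hz => right_ne_zero_of_mul hz

/-- A smooth cutoff function which is `1` near a compact set and is supported in a given
neighbourhood of it. -/
theorem exists_cutoff [FiniteDimensional ℝ E] {K U : Set E} (hK : IsCompact K) (hU : IsOpen U) (hKU : K ⊆ U) :
    ∃ χ : E → ℝ, ∃ δ > 0, IsBumpFunction χ ∧ (∀ z, χ z ≤ 1) ∧ tsupport χ ⊆ U ∧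
      ∀ z ∈ Metric.cthickening δ K, χ z = 1 := by
  obtain ⟨δ, hδ, hδU⟩ := hK.exists_cthickening_subset_open hU hKU
  have hsub : Metric.cthickening (δ / 2) K ⊆ interior (Metric.cthickening δ K) :=
    (Metric.cthickening_subset_thickening' hδ (by linarith) K).trans
      (Metric.thickening_subset_interior_cthickening δ K)
  obtain ⟨χ, h1, h2, h3⟩ := exists_contMDiffMap_one_nhds_of_subset_interior (n := ⊤)
    (modelWithCornersSelf ℝ E) (Metric.isClosed_cthickening (δ := δ / 2) (E := K)) hsub
  have hsupp : tsupport χ ⊆ Metric.cthickening δ K := by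
    refine closure_minimal (fun z hz => ?_) Metric.isClosed_cthickening
    by_contra hne
    exact hz (h2 z hne)
  refine ⟨χ, δ / 2, by positivity, ⟨χ.contMDiff.contDiff, ?_, fun z => (h3 z).1⟩,
    fun z => (h3 z).2, hsupp.trans hδU, fun z hz => h1.self_of_nhdsSet z hz⟩
  exact HasCompactSupport.of_support_subset_isCompact hK.cthickening
    ((subset_tsupport _).trans hsupp)

end Bump

/-! ### Integrability of differentials tested on bounded fields -/

section WeakForm

variable {E : Type*} [NormedAddCommGroup E] [NormedSpace ℝ E] [FiniteDimensional ℝ E]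
  [MeasurableSpace E] [BorelSpace E]

theorem integrable_apply_of_hasCompactSupport {X : Type*} [TopologicalSpace X] [MeasurableSpace X]
    [OpensMeasurableSpace X] [SecondCountableTopology X]
    {ν : Measure X} [IsFiniteMeasureOnCompacts ν] {p : X → E →L[ℝ] ℝ} (hp : Continuous p)
    (hpc : HasCompactSupport p) {V : X → E} (hV : Measurable V) {B : ℝ} (hVB : ∀ x, ‖V x‖ ≤ B) :
    Integrable (fun x => p x (V x)) ν := by
  have h1 : Integrable (fun x => ‖p x‖ * B) ν :=
    (hp.integrable_of_hasCompactSupport hpc).norm.mul_const B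
  refine h1.mono' ?_ (Eventually.of_forall fun x => ?_)
  · have := hp.stronglyMeasurable.prodMk hV.stronglyMeasurable
    exact (isBoundedBilinearMap_apply.continuous.comp_stronglyMeasurable this).aestronglyMeasurable
  · exact (p x).le_opNorm_of_le (hVB x)

theorem IsBumpFunction.integrable_fderiv {ν : Measure E} [IsFiniteMeasureOnCompacts ν] {φ : E → ℝ}
    (hφ : IsBumpFunction φ) {V : E → E} (hV : Measurable V) {B : ℝ} (hVB : ∀ x, ‖V x‖ ≤ B) :
    Integrable (fun x => fderiv ℝ φ x (V x)) ν :=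
  integrable_apply_of_hasCompactSupport hφ.continuous_fderiv (hφ.hasCompactSupport.fderiv ℝ) hV hVB

end WeakForm

/-! ### Doubling of variables with a one-sided kernel -/

section Doubling

variable {E : Type*} [NormedAddCommGroup E] [NormedSpace ℝ E] [FiniteDimensional ℝ E]
  [MeasurableSpace E] [BorelSpace E] {μ : Measure E} [μ.IsAddHaarMeasure]

/-- Doubled test functions are localized in `z` and in `z' - z`; the shear `(z, h) ↦ (z, z + h)`
carries `K × L` to a compact set. -/
theorem hasCompactSupport_of_shear {E F : Type*} [NormedAddCommGroup E] [Zero F] {p : E × E → F}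
    {K L : Set E} (hK : IsCompact K) (hL : IsCompact L)
    (hp : ∀ q, p q ≠ 0 → q.1 ∈ K ∧ q.2 - q.1 ∈ L) : HasCompactSupport p := by
  have hc : Continuous fun q : E × E => (q.1, q.1 + q.2) := by fun_prop
  refine HasCompactSupport.intro ((hK.prod hL).image hc) fun q hq => ?_
  by_contra hne
  exact hq ⟨(q.1, q.2 - q.1), hp q hne, by simp⟩

/-- The mollification `z' ↦ ∫_Q ξ(z) ρ(z' - z) dz`. -/
noncomputable def mollify (μ : Measure E) (Q : Set E) (ξ ρ : E → ℝ) (z' : E) : ℝ :=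
  ∫ z in Q, ξ z * ρ (z' - z) ∂μ

theorem mollify_eq_convolution {Q : Set E} (hQ : MeasurableSet Q) (ξ ρ : E → ℝ) :
    mollify μ Q ξ ρ = convolution (Q.indicator ξ) ρ (ContinuousLinearMap.mul ℝ ℝ) μ := by
  ext z'
  simp only [mollify, convolution, ContinuousLinearMap.mul_apply']
  rw [← integral_indicator hQ]
  congr 1
  ext z
  by_cases hz : z ∈ Q <;> simp [hz]

theorem locallyIntegrable_indicator {Q : Set E} (hQ : MeasurableSet Q) {ξ : E → ℝ}
    (hξ : IsBumpFunction ξ) : LocallyIntegrable (Q.indicator ξ) μ :=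
  ((hξ.contDiff.continuous.integrable_of_hasCompactSupport hξ.hasCompactSupport).indicator
    hQ).locallyIntegrable

theorem hasFDerivAt_mollify {Q : Set E} (hQ : MeasurableSet Q) {ξ ρ : E → ℝ}
    (hξ : IsBumpFunction ξ) (hρ : IsBumpFunction ρ) (z' : E) :
    HasFDerivAt (mollify μ Q ξ ρ) (∫ z in Q, ξ z • fderiv ℝ ρ (z' - z) ∂μ) z' := by
  rw [mollify_eq_convolution hQ]
  refine (hρ.hasCompactSupport.hasFDerivAt_convolution_right (ContinuousLinearMap.mul ℝ ℝ)
    (locallyIntegrable_indicator (μ := μ) hQ hξ) (hρ.contDiff.of_le (by simp)) z').congr_fderiv ?_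
  simp only [convolution]
  rw [← integral_indicator hQ]
  congr 1
  ext z w
  by_cases hz : z ∈ Q <;> simp [hz, ContinuousLinearMap.precompR_apply]

theorem exists_of_mollify_ne_zero {Q : Set E} {ξ ρ : E → ℝ} {z' : E}
    (h : mollify μ Q ξ ρ z' ≠ 0) : ∃ z ∈ Q, ξ z ≠ 0 ∧ ρ (z' - z) ≠ 0 := by
  by_contra! hne
  refine h ?_
  rw [mollify, setIntegral_eq_zero_of_forall_eq_zero]
  intro z hz
  by_cases hξ : ξ z = 0
  · simp [hξ]
  · simp [hne z hz hξ]

/-- When the kernel pushes `tsupport ξ ∩ closure Q` into `Q`, this sum set lies in `Q`, so the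
mollified function is admissible for the interior inequalities. -/
theorem tsupport_mollify_subset {Q : Set E} {ξ ρ : E → ℝ}
    (hξ : IsBumpFunction ξ) (hρ : IsBumpFunction ρ) :
    tsupport (mollify μ Q ξ ρ) ⊆
      (fun p : E × E => p.1 + p.2) '' ((tsupport ξ ∩ closure Q) ×ˢ tsupport ρ) := by
  have hK : IsCompact ((fun p : E × E => p.1 + p.2) ''
      ((tsupport ξ ∩ closure Q) ×ˢ tsupport ρ)) :=
    ((hξ.hasCompactSupport.isCompact.inter_right isClosed_closure).prod
      hρ.hasCompactSupport.isCompact).image continuous_add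
  refine closure_minimal (fun z' hz' => ?_) hK.isClosed
  obtain ⟨z, hz, h1, h2⟩ := exists_of_mollify_ne_zero hz'
  exact ⟨(z, z' - z), ⟨⟨subset_tsupport _ h1, subset_closure hz⟩, subset_tsupport _ h2⟩, by simp⟩

theorem isBumpFunction_mollify {Q : Set E} (hQ : MeasurableSet Q) {ξ ρ : E → ℝ}
    (hξ : IsBumpFunction ξ) (hρ : IsBumpFunction ρ) : IsBumpFunction (mollify μ Q ξ ρ) where
  contDiff := by
    rw [mollify_eq_convolution hQ]
    exact hρ.hasCompactSupport.contDiff_convolution_right (n := ⊤) _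
      (locallyIntegrable_indicator hQ hξ) hρ.contDiff
  hasCompactSupport := by
    refine HasCompactSupport.of_support_subset_isCompact
      (((hξ.hasCompactSupport.isCompact.inter_right isClosed_closure).prod
      hρ.hasCompactSupport.isCompact).image continuous_add)
      ((subset_tsupport _).trans (tsupport_mollify_subset hξ hρ))
  nonneg z' := integral_nonneg fun z => mul_nonneg (hξ.nonneg z) (hρ.nonneg _)

theorem integral_sub_left_bump {ρ : E → ℝ} (z : E) :
    ∫ z', ρ (z' - z) ∂μ = ∫ h, ρ h ∂μ := integral_sub_right_eq_self ρ z

theorem mollify_le {Q : Set E} {ξ ρ : E → ℝ} (hξ : IsBumpFunction ξ)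
    (hρ : IsBumpFunction ρ) (hρ1 : ∫ h, ρ h ∂μ = 1) {B : ℝ} (hB : ∀ z, ξ z ≤ B) (z' : E) :
    mollify μ Q ξ ρ z' ≤ B := by
  have hint : Integrable (fun z => ρ (z' - z)) μ :=
    (hρ.contDiff.continuous.integrable_of_hasCompactSupport hρ.hasCompactSupport).comp_sub_left z'
  have hB0 : 0 ≤ B := (hξ.nonneg 0).trans (hB 0)
  calc mollify μ Q ξ ρ z' ≤ ∫ z in Q, B * ρ (z' - z) ∂μ := by
        refine integral_mono_of_nonneg (Eventually.of_forall fun z =>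
          mul_nonneg (hξ.nonneg z) (hρ.nonneg _)) (hint.const_mul B).integrableOn
          (Eventually.of_forall fun z => mul_le_mul_of_nonneg_right (hB z) (hρ.nonneg _))
    _ ≤ ∫ z, B * ρ (z' - z) ∂μ := setIntegral_le_integral (hint.const_mul B)
        (Eventually.of_forall fun z => mul_nonneg hB0 (hρ.nonneg _))
    _ = B := by rw [integral_const_mul, integral_sub_left_eq_self, hρ1, mul_one]

/-- Doubling of variables with a one-sided kernel `ρ`: the inequality for `u` is used up to the
boundary, for levels at least `k`, with boundary terms controlled by `ν`; the inequality for `v` is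
used in the interior only. -/
theorem doubling_variables {Q : Set E} (hQ : MeasurableSet Q) {G : ℝ → E} {C : NNReal} {M : ℝ}
    (hGc : Continuous G) (hG : LipschitzOnWith C G (Icc (-M) M)) {u v : E → ℝ}
    (hu : Measurable u) (hv : Measurable v) (huM : ∀ z, u z ∈ Icc (-M) M)
    (hvM : ∀ z, v z ∈ Icc (-M) M) {k : ℝ} (hk : k ∈ Icc (-M) M)
    {ν : Measure E} [IsFiniteMeasureOnCompacts ν] {ξ ρ : E → ℝ} (hξ : IsBumpFunction ξ)
    (hρ : IsBumpFunction ρ) (hρ1 : ∫ h, ρ h ∂μ = 1)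
    (hshift : ∀ z ∈ tsupport ξ ∩ closure Q, ∀ h ∈ tsupport ρ, z + h ∈ Q)
    (hsub : ∀ κ ∈ Icc k M, ∀ φ, IsBumpFunction φ → tsupport φ ⊆ tsupport ξ →
      0 ≤ ∫ z in Q, fderiv ℝ φ z (fluxJump G (u z) κ) ∂μ + ∫ z, φ z ∂ν)
    (hsup : ∀ κ ∈ Icc (-M) M, ∀ φ, IsBumpFunction φ → tsupport φ ⊆ Q →
      0 ≤ ∫ z in Q, fderiv ℝ φ z (fluxJump G κ (v z)) ∂μ)
    {ε : ℝ} (hε : ∀ h ∈ tsupport ρ, ∫ z in Q, fderiv ℝ ξ z (fluxJump G (u z) (max (v (z + h)) k)) ∂μ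
      ≤ ∫ z in Q, fderiv ℝ ξ z (fluxJump G (u z) (max (v z) k)) ∂μ + ε) :
    0 ≤ ∫ z in Q, fderiv ℝ ξ z (fluxJump G (u z) (max (v z) k)) ∂μ + ε + ∫ z, ξ z ∂ν
      + ∫ z in Q, fderiv ℝ (mollify μ Q ξ ρ) z (fluxJump G k (v z)) ∂μ := by
  have hJ := continuous_fluxJump hGc
  have hmax : ∀ z, max (v z) k ∈ Icc (-M) M := fun z =>
    ⟨(hvM z).1.trans (le_max_left _ _), max_le (hvM z).2 hk.2⟩
  have hJB : ∀ a ∈ Icc (-M) M, ∀ b ∈ Icc (-M) M, ‖fluxJump G a b‖ ≤ 2 * C * (2 * M) := by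
    intro a ha b hb
    refine (norm_fluxJump_le hG ha hb).trans ?_
    have : |b - a| ≤ 2 * M := by rw [abs_le]; constructor <;> linarith [ha.1, ha.2, hb.1, hb.2]
    gcongr
  have hξc := hξ.contDiff.continuous
  have hρc := hρ.contDiff.continuous
  have hDξc := hξ.continuous_fderiv
  have hDρc := hρ.continuous_fderiv
  have hDξ0 : ∀ z, fderiv ℝ ξ z ≠ 0 → z ∈ tsupport ξ := fun z hz =>
    tsupport_fderiv_subset ℝ (subset_tsupport _ hz)
  have hDρ0 : ∀ z, fderiv ℝ ρ z ≠ 0 → z ∈ tsupport ρ := fun z hz =>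
    tsupport_fderiv_subset ℝ (subset_tsupport _ hz)
  have hKξ := hξ.hasCompactSupport.isCompact
  have hKρ := hρ.hasCompactSupport.isCompact
  -- measurability of the jumps in the doubled variables
  have hVm : Measurable fun p : E × E => fluxJump G (u p.1) (max (v p.2) k) :=
    hJ.measurable.comp ((hu.comp measurable_fst).prodMk
      ((hv.comp measurable_snd).max measurable_const))
  have hV'm : Measurable fun p : E × E => fluxJump G (u p.1) (max (v (p.1 + p.2)) k) :=
    hJ.measurable.comp ((hu.comp measurable_fst).prodMk
      ((hv.comp (measurable_fst.add measurable_snd)).max measurable_const))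
  have hNm : Measurable fun p : E × E => fluxJump G k (v p.2) :=
    hJ.measurable.comp (measurable_const.prodMk (hv.comp measurable_snd))
  -- The `z`-differential of `ξ(z) ρ(z' - z)` is `pa - pb`, and its `z'`-differential is `pb`; the
  -- `pb` terms carrying the same jump cancel when the two inequalities are added. `pc` is `pa`
  -- after the substitution `z' = z + h`.
  set pa : E × E → E →L[ℝ] ℝ := fun p => ρ (p.2 - p.1) • fderiv ℝ ξ p.1 with hpa
  set pb : E × E → E →L[ℝ] ℝ := fun p => ξ p.1 • fderiv ℝ ρ (p.2 - p.1) with hpb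
  set pc : E × E → E →L[ℝ] ℝ := fun p => ρ p.2 • fderiv ℝ ξ p.1 with hpc
  have hpac : Continuous pa := by fun_prop
  have hpbc : Continuous pb := by fun_prop
  have hpcc : Continuous pc := by fun_prop
  have hpas : HasCompactSupport pa := hasCompactSupport_of_shear hKξ hKρ fun q hq =>
    ⟨hDξ0 _ (right_ne_zero_of_smul hq), subset_tsupport _ (left_ne_zero_of_smul hq)⟩
  have hpbs : HasCompactSupport pb := hasCompactSupport_of_shear hKξ hKρ fun q hq =>
    ⟨subset_tsupport _ (left_ne_zero_of_smul hq), hDρ0 _ (right_ne_zero_of_smul hq)⟩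
  have hpcs : HasCompactSupport pc := by
    refine HasCompactSupport.intro (hKξ.prod hKρ) fun q hq => ?_
    by_contra hne
    exact hq ⟨hDξ0 _ (right_ne_zero_of_smul hne), subset_tsupport _ (left_ne_zero_of_smul hne)⟩
  set μQ := μ.restrict Q with hμQ
  have : IsFiniteMeasureOnCompacts μQ := inferInstance
  have iA : Integrable (fun p : E × E => pa p (fluxJump G (u p.1) (max (v p.2) k)))
      (μQ.prod μQ) := integrable_apply_of_hasCompactSupport hpac hpas hVm
    fun p => hJB _ (huM _) _ (hmax _)
  have iB : Integrable (fun p : E × E => pb p (fluxJump G (u p.1) (max (v p.2) k)))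
      (μQ.prod μQ) := integrable_apply_of_hasCompactSupport hpbc hpbs hVm
    fun p => hJB _ (huM _) _ (hmax _)
  have iN : Integrable (fun p : E × E => pb p (fluxJump G k (v p.2)))
      (μQ.prod μQ) := integrable_apply_of_hasCompactSupport hpbc hpbs hNm
    fun p => hJB _ hk _ (hvM _)
  have iC : Integrable (fun p : E × E => pc p (fluxJump G (u p.1) (max (v (p.1 + p.2)) k)))
      (μQ.prod μ) := integrable_apply_of_hasCompactSupport hpcc hpcs hV'm
    fun p => hJB _ (huM _) _ (hmax _)
  have iL : Integrable (fun p : E × E => ξ p.1 * ρ (p.2 - p.1)) (ν.prod μQ) := by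
    refine Continuous.integrable_of_hasCompactSupport (by fun_prop)
      (hasCompactSupport_of_shear hKξ hKρ fun q hq => ?_)
    exact ⟨subset_tsupport _ (left_ne_zero_of_mul hq), subset_tsupport _ (right_ne_zero_of_mul hq)⟩
  -- the inequality for `u`
  have h1 : ∀ z' ∈ Q, 0 ≤ ∫ z, pa (z, z') (fluxJump G (u z) (max (v z') k)) ∂μQ
      - ∫ z, pb (z, z') (fluxJump G (u z) (max (v z') k)) ∂μQ + ∫ z, ξ z * ρ (z' - z) ∂ν := by
    intro z' _
    have hφ : IsBumpFunction fun z => ξ z * ρ (z' - z) :=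
      hξ.mul (hρ.contDiff.comp (contDiff_const.sub contDiff_id)) fun z => hρ.nonneg _
    have hd : ∀ z, fderiv ℝ (fun z => ξ z * ρ (z' - z)) z = pa (z, z') - pb (z, z') := by
      intro z
      have e1 : HasFDerivAt ξ (fderiv ℝ ξ z) z := (hξ.differentiable z).hasFDerivAt
      have e2 : HasFDerivAt (fun z => ρ (z' - z)) (-fderiv ℝ ρ (z' - z)) z := by
        have e3 : HasFDerivAt ρ (fderiv ℝ ρ (z' - z)) (z' - z) :=
          (hρ.differentiable _).hasFDerivAt
        exact (e3.comp z ((hasFDerivAt_id z).const_sub z')).congr_fderiv (by ext; simp)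
      rw [(e1.fun_mul e2).fderiv]
      ext w
      simp [hpa, hpb]
      ring
    have := hsub (max (v z') k) ⟨le_max_right _ _, (hmax z').2⟩ _ hφ
      (tsupport_mul_subset_left' ξ fun z => ρ (z' - z))
    simp only [hd, sub_apply] at this
    rwa [integral_sub] at this
    · refine integrable_apply_of_hasCompactSupport (by fun_prop) ?_ (by fun_prop)
        fun z => hJB _ (huM _) _ (hmax _)
      exact HasCompactSupport.intro hKξ fun z hz => by
        by_contra hne
        exact hz (hDξ0 _ (right_ne_zero_of_smul hne))
    · refine integrable_apply_of_hasCompactSupport (by fun_prop) ?_ (by fun_prop)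
        fun z => hJB _ (huM _) _ (hmax _)
      exact HasCompactSupport.intro hKξ fun z hz => by
        by_contra hne
        exact hz (subset_tsupport _ (left_ne_zero_of_smul hne))
  -- the inequality for `v`
  have h2 : ∀ z ∈ Q, 0 ≤ ∫ z', (pb (z, z') (fluxJump G (u z) (max (v z') k))
      + pb (z, z') (fluxJump G k (v z'))) ∂μQ := by
    intro z hz
    have hd : ∀ z', fderiv ℝ (fun z' => ρ (z' - z) * ξ z) z' = pb (z, z') := by
      intro z'
      have e3 : HasFDerivAt ρ (fderiv ℝ ρ (z' - z)) (z' - z) :=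
        (hρ.differentiable _).hasFDerivAt
      have e2 : HasFDerivAt (fun z' => ρ (z' - z)) (fderiv ℝ ρ (z' - z)) z' := by
        exact (e3.comp z' ((hasFDerivAt_id z').sub_const z)).congr_fderiv (by ext; simp)
      rw [(e2.mul_const (ξ z)).fderiv]
    have hcl : IsClosed ((fun z' => z' - z) ⁻¹' tsupport ρ) :=
      (isClosed_tsupport ρ).preimage (by fun_prop)
    have hts : tsupport (fun z' => ρ (z' - z) * ξ z) ⊆ (fun z' => z' - z) ⁻¹' tsupport ρ :=
      closure_minimal (fun z' hz' => subset_tsupport _ (left_ne_zero_of_mul hz')) hcl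
    have hφ : IsBumpFunction fun z' => ρ (z' - z) * ξ z := by
      refine IsBumpFunction.mul (φ := fun z' => ρ (z' - z)) (ψ := fun _ => ξ z)
        ⟨hρ.contDiff.comp (contDiff_id.sub contDiff_const), ?_, fun z' => hρ.nonneg _⟩
        contDiff_const fun _ => hξ.nonneg z
      exact hρ.hasCompactSupport.comp_homeomorph (Homeomorph.subRight z)
    -- The level `max (u z) k` is matched to the level `max (v z') k` used for `u`: by
    -- `fluxJump_sup_add` the two jumps differ by `fluxJump G k (v z')`.
    have := hsup (max (u z) k) ⟨(huM z).1.trans (le_max_left _ _), max_le (huM z).2 hk.2⟩ _ hφ ?_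
    · simp only [hd, ← fluxJump_sup_add, map_add] at this
      exact this
    · by_cases hz0 : ξ z = 0
      · have : (fun z' => ρ (z' - z) * ξ z) = 0 := by ext; simp [hz0]
        rw [this]
        simp
      · intro z' hz'
        have := hshift z ⟨subset_tsupport _ hz0, subset_closure hz⟩ _ (hts hz')
        simpa using this
  -- integration of the two inequalities
  have h1' : 0 ≤ ∫ z', (∫ z, pa (z, z') (fluxJump G (u z) (max (v z') k)) ∂μQ
      - ∫ z, pb (z, z') (fluxJump G (u z) (max (v z') k)) ∂μQ + ∫ z, ξ z * ρ (z' - z) ∂ν) ∂μQ :=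
    setIntegral_nonneg hQ h1
  have h2' : 0 ≤ ∫ z, ∫ z', (pb (z, z') (fluxJump G (u z) (max (v z') k))
      + pb (z, z') (fluxJump G k (v z'))) ∂μQ ∂μQ := setIntegral_nonneg hQ h2
  have jA := iA.integral_prod_right
  have jB := iB.integral_prod_right
  have jL := iL.integral_prod_right
  simp only at jA jB jL
  rw [integral_add (by exact jA.sub jB) jL, integral_sub jA jB] at h1'
  rw [integral_integral_swap (f := fun z z' => pb (z, z') (fluxJump G (u z) (max (v z') k))
      + pb (z, z') (fluxJump G k (v z'))) (iB.add iN)] at h2'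
  have hsplit : ∫ z', ∫ z, (pb (z, z') (fluxJump G (u z) (max (v z') k))
      + pb (z, z') (fluxJump G k (v z'))) ∂μQ ∂μQ
      = ∫ z', ∫ z, pb (z, z') (fluxJump G (u z) (max (v z') k)) ∂μQ ∂μQ
        + ∫ z', ∫ z, pb (z, z') (fluxJump G k (v z')) ∂μQ ∂μQ := by
    have := integral_prod_symm _ (iB.add iN)
    have e1 := integral_prod_symm _ iB
    have e2 := integral_prod_symm _ iN
    simp only [Pi.add_apply] at this
    rw [← this, ← e1, ← e2, ← integral_add iB iN]
  rw [hsplit] at h2'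
  -- the boundary term
  have hLle : ∫ z', ∫ z, ξ z * ρ (z' - z) ∂ν ∂μQ ≤ ∫ z, ξ z ∂ν := by
    rw [← integral_integral_swap (f := fun z z' => ξ z * ρ (z' - z)) iL]
    refine integral_mono_of_nonneg (Eventually.of_forall fun z => integral_nonneg fun z' =>
      mul_nonneg (hξ.nonneg _) (hρ.nonneg _))
      (hξc.integrable_of_hasCompactSupport hξ.hasCompactSupport) (Eventually.of_forall fun z => ?_)
    have hint : Integrable (fun z' => ρ (z' - z)) μ :=
      (hρc.integrable_of_hasCompactSupport hρ.hasCompactSupport).comp_sub_right z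
    calc ∫ z', ξ z * ρ (z' - z) ∂μQ ≤ ∫ z', ξ z * ρ (z' - z) ∂μ :=
          setIntegral_le_integral (hint.const_mul _)
            (Eventually.of_forall fun z' => mul_nonneg (hξ.nonneg _) (hρ.nonneg _))
      _ = ξ z := by rw [integral_const_mul, integral_sub_left_bump, hρ1, mul_one]
  -- the term carrying the mollified test function
  have hN : ∫ z', ∫ z, pb (z, z') (fluxJump G k (v z')) ∂μQ ∂μQ
      = ∫ z in Q, fderiv ℝ (mollify μ Q ξ ρ) z (fluxJump G k (v z)) ∂μ := by
    refine integral_congr_ae (Eventually.of_forall fun z' => ?_)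
    simp only
    rw [(hasFDerivAt_mollify hQ hξ hρ z').fderiv, ContinuousLinearMap.integral_apply]
    refine Continuous.integrable_of_hasCompactSupport (by fun_prop) ?_
    exact HasCompactSupport.intro hKξ fun z hz => by
      by_contra hne
      exact hz (subset_tsupport _ (left_ne_zero_of_smul hne))
  -- the main term
  have hA : ∫ z', ∫ z, pa (z, z') (fluxJump G (u z) (max (v z') k)) ∂μQ ∂μQ
      = ∫ h, ρ h * ∫ z in Q, fderiv ℝ ξ z (fluxJump G (u z) (max (v (z + h)) k)) ∂μ ∂μ := by
    rw [← integral_integral_swap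
      (f := fun z z' => pa (z, z') (fluxJump G (u z) (max (v z') k))) iA]
    have e1 : ∀ z ∈ Q, ∫ z', pa (z, z') (fluxJump G (u z) (max (v z') k)) ∂μQ
        = ∫ h, pc (z, h) (fluxJump G (u z) (max (v (z + h)) k)) ∂μ := by
      intro z hz
      -- One-sidedness of the kernel: where the integrand is nonzero, `z'` is already in `Q`, so the
      -- integral extends to the whole space and can be translated.
      have e2 : ∫ z', pa (z, z') (fluxJump G (u z) (max (v z') k)) ∂μQ
          = ∫ z', pa (z, z') (fluxJump G (u z) (max (v z') k)) ∂μ := by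
        refine setIntegral_eq_integral_of_forall_compl_eq_zero fun z' hz' => ?_
        by_contra hne
        have hne' : pa (z, z') ≠ 0 := fun h0 => hne (by simp [h0])
        have := hshift z ⟨hDξ0 _ (right_ne_zero_of_smul hne'), subset_closure hz⟩ (z' - z)
          (subset_tsupport _ (left_ne_zero_of_smul hne'))
        exact hz' (by simpa using this)
      rw [e2, ← integral_add_right_eq_self _ z]
      refine integral_congr_ae (Eventually.of_forall fun h => ?_)
      simp [hpa, hpc, add_comm z h]
    rw [setIntegral_congr_fun hQ e1,
      integral_integral_swap (f := fun z h => pc (z, h) (fluxJump G (u z) (max (v (z + h)) k))) iC]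
    refine integral_congr_ae (Eventually.of_forall fun h => ?_)
    simp [hpc, integral_const_mul, hμQ]
  have hAle : ∫ h, ρ h * ∫ z in Q, fderiv ℝ ξ z (fluxJump G (u z) (max (v (z + h)) k)) ∂μ ∂μ
      ≤ ∫ z in Q, fderiv ℝ ξ z (fluxJump G (u z) (max (v z) k)) ∂μ + ε := by
    have jC := iC.integral_prod_right
    have e3 : (fun h => ∫ z, pc (z, h) (fluxJump G (u z) (max (v (z + h)) k)) ∂μQ)
        = fun h => ρ h * ∫ z in Q, fderiv ℝ ξ z (fluxJump G (u z) (max (v (z + h)) k)) ∂μ := by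
      ext h
      simp [hpc, integral_const_mul, hμQ]
    simp only at jC
    rw [e3] at jC
    have hρi : Integrable ρ μ := hρc.integrable_of_hasCompactSupport hρ.hasCompactSupport
    calc _ ≤ ∫ h, ρ h * (∫ z in Q, fderiv ℝ ξ z (fluxJump G (u z) (max (v z) k)) ∂μ + ε) ∂μ := by
          refine integral_mono jC (hρi.mul_const _) fun h => ?_
          by_cases hh : ρ h = 0
          · simp [hh]
          · exact mul_le_mul_of_nonneg_left (hε h (subset_tsupport _ hh)) (hρ.nonneg h)
      _ = _ := by rw [integral_mul_const, hρ1, one_mul]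
  rw [hA] at h1'
  rw [hN] at h2'
  linarith

/-- The error made in the main term when `v` is translated. -/
theorem eventually_translate_le {Q : Set E} {G : ℝ → E} {C : NNReal} {M : ℝ}
    (hGc : Continuous G) (hG : LipschitzOnWith C G (Icc (-M) M)) {u v : E → ℝ}
    (hu : Measurable u) (hv : Measurable v) (huM : ∀ z, u z ∈ Icc (-M) M)
    (hvM : ∀ z, v z ∈ Icc (-M) M) {k : ℝ} (hk : k ∈ Icc (-M) M) {ξ : E → ℝ}
    (hξ : IsBumpFunction ξ) {ε : ℝ} (hε : 0 < ε) :
    ∀ᶠ h in 𝓝 (0 : E), ∫ z in Q, fderiv ℝ ξ z (fluxJump G (u z) (max (v (z + h)) k)) ∂μ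
      ≤ ∫ z in Q, fderiv ℝ ξ z (fluxJump G (u z) (max (v z) k)) ∂μ + ε := by
  have hmax : ∀ z, max (v z) k ∈ Icc (-M) M := fun z =>
    ⟨(hvM z).1.trans (le_max_left _ _), max_le (hvM z).2 hk.2⟩
  have hJB : ∀ a ∈ Icc (-M) M, ∀ b ∈ Icc (-M) M, ‖fluxJump G a b‖ ≤ 2 * C * (2 * M) := by
    intro a ha b hb
    refine (norm_fluxJump_le hG ha hb).trans ?_
    have : |b - a| ≤ 2 * M := by rw [abs_le]; constructor <;> linarith [ha.1, ha.2, hb.1, hb.2]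
    gcongr
  have hJ := continuous_fluxJump hGc
  obtain ⟨D, hD⟩ := hξ.continuous_fderiv.bounded_above_of_compact_support
    (hξ.hasCompactSupport.fderiv ℝ)
  have hD0 : 0 ≤ D := (norm_nonneg _).trans (hD 0)
  set K := tsupport ξ
  have hK : IsCompact K := hξ.hasCompactSupport.isCompact
  have hvM' : ∀ z, |v z| ≤ M := fun z => abs_le.2 (hvM z)
  have hlim := (tendsto_setIntegral_norm_translate_sub (μ := μ) hv hvM' hK).const_mul (D * (2 * C))
  rw [mul_zero] at hlim
  have hm : ∀ h : E, Measurable fun z => fluxJump G (u z) (max (v (z + h)) k) := fun h =>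
    hJ.measurable.comp (hu.prodMk ((hv.comp (measurable_add_const h)).max measurable_const))
  have hint : ∀ h : E, Integrable
      (fun z => fderiv ℝ ξ z (fluxJump G (u z) (max (v (z + h)) k))) (μ.restrict Q) := fun h =>
    hξ.integrable_fderiv (hm h) fun z => hJB _ (huM z) _ (hmax _)
  have hint0 : Integrable
      (fun z => fderiv ℝ ξ z (fluxJump G (u z) (max (v z) k))) (μ.restrict Q) := by
    simpa using hint 0
  filter_upwards [hlim.eventually_le_const hε] with h hh
  rw [← sub_le_iff_le_add', ← integral_sub (hint h) hint0]
  refine le_trans ?_ hh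
  have hbd : Integrable (fun z => K.indicator (fun z => D * (2 * C) * |v (z + h) - v z|) z) μ := by
    rw [integrable_indicator_iff hK.measurableSet]
    refine Measure.integrableOn_of_bounded (M := D * (2 * C) * (M + M)) hK.measure_lt_top.ne
      (((hv.comp (measurable_add_const h)).sub hv).norm.const_mul _).aestronglyMeasurable
      (Eventually.of_forall fun z => ?_)
    rw [Real.norm_of_nonneg (by positivity)]
    have := (abs_sub (v (z + h)) (v z)).trans (add_le_add (hvM' _) (hvM' _))
    gcongr
  have hpt : ∀ z, fderiv ℝ ξ z (fluxJump G (u z) (max (v (z + h)) k))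
      - fderiv ℝ ξ z (fluxJump G (u z) (max (v z) k))
      ≤ K.indicator (fun z => D * (2 * C) * |v (z + h) - v z|) z := by
    intro z
    rw [← map_sub]
    by_cases hz : z ∈ K
    · rw [indicator_of_mem hz]
      have h1 := norm_fluxJump_sub_le hG (huM z) (hmax (z + h)) (hmax z)
      have h2 : |max (v (z + h)) k - max (v z) k| ≤ |v (z + h) - v z| :=
        abs_max_sub_max_le_abs _ _ _
      have h3 : ‖fluxJump G (u z) (max (v (z + h)) k) - fluxJump G (u z) (max (v z) k)‖
          ≤ 2 * C * |v (z + h) - v z| := h1.trans (by gcongr)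
      calc _ ≤ ‖fderiv ℝ ξ z (fluxJump G (u z) (max (v (z + h)) k)
              - fluxJump G (u z) (max (v z) k))‖ := Real.le_norm_self _
        _ ≤ ‖fderiv ℝ ξ z‖ * (2 * C * |v (z + h) - v z|) :=
            (fderiv ℝ ξ z).le_opNorm_of_le h3
        _ ≤ D * (2 * C * |v (z + h) - v z|) := by gcongr; exact hD z
        _ = _ := by ring
    · have : fderiv ℝ ξ z = 0 := by
        by_contra hne
        exact hz (tsupport_fderiv_subset ℝ (subset_tsupport _ hne))
      simp [this, hz]
  calc _ ≤ ∫ z in Q, K.indicator (fun z => D * (2 * C) * |v (z + h) - v z|) z ∂μ :=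
        integral_mono ((hint h).sub hint0) hbd.integrableOn hpt
    _ ≤ ∫ z, K.indicator (fun z => D * (2 * C) * |v (z + h) - v z|) z ∂μ :=
        setIntegral_le_integral hbd (Eventually.of_forall fun z =>
          indicator_nonneg (fun z _ => by positivity) z)
    _ = _ := by rw [integral_indicator hK.measurableSet, integral_const_mul]

end Doubling

/-! ### Entropy defect near the boundary and the local Kato inequality -/

section LocalKato

variable {E : Type*} [NormedAddCommGroup E] [NormedSpace ℝ E] [FiniteDimensional ℝ E]
  [MeasurableSpace E] [BorelSpace E] {μ : Measure E} [μ.IsAddHaarMeasure]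

theorem fderiv_bump_add {φ ψ : E → ℝ} (hφ : IsBumpFunction φ) (hψ : IsBumpFunction ψ) (z w : E) :
    fderiv ℝ (fun z => φ z + ψ z) z w = fderiv ℝ φ z w + fderiv ℝ ψ z w := by
  rw [((hφ.differentiable z).hasFDerivAt.fun_add (hψ.differentiable z).hasFDerivAt).fderiv]
  simp

theorem IsBumpFunction.integrable {ν : Measure E} [IsFiniteMeasureOnCompacts ν] {φ : E → ℝ}
    (hφ : IsBumpFunction φ) : Integrable φ ν :=
  hφ.contDiff.continuous.integrable_of_hasCompactSupport hφ.hasCompactSupport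

theorem integral_fderiv_add {ν : Measure E} [IsFiniteMeasureOnCompacts ν] {φ ψ : E → ℝ}
    (hφ : IsBumpFunction φ) (hψ : IsBumpFunction ψ) {V : E → E} (hV : Measurable V) {B : ℝ}
    (hVB : ∀ z, ‖V z‖ ≤ B) :
    ∫ z, fderiv ℝ (fun z => φ z + ψ z) z (V z) ∂ν
      = ∫ z, fderiv ℝ φ z (V z) ∂ν + ∫ z, fderiv ℝ ψ z (V z) ∂ν := by
  simp only [fderiv_bump_add hφ hψ]
  exact integral_add (hφ.integrable_fderiv hV hVB) (hψ.integrable_fderiv hV hVB)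

/-- The entropy defect measure in `Q` does not charge thin layers along `∂Q`. -/
theorem exists_compact_small_defect {Q : Set E} {V : E → E} (hV : Measurable V) {B : ℝ}
    (hVB : ∀ z, ‖V z‖ ≤ B) {ν : Measure E} [IsFiniteMeasureOnCompacts ν] {Ξ : E → ℝ}
    (hΞ : IsBumpFunction Ξ)
    (hbd : ∀ φ, IsBumpFunction φ → (∀ z, φ z ≤ Ξ z) →
      0 ≤ ∫ z in Q, fderiv ℝ φ z (V z) ∂μ + ∫ z, φ z ∂ν) {ε : ℝ} (hε : 0 < ε) :
    ∃ K ⊆ Q, IsCompact K ∧ ∀ θ, IsBumpFunction θ → (∀ z, θ z ≤ Ξ z) → tsupport θ ⊆ Q →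
      Disjoint (tsupport θ) K → ∫ z in Q, fderiv ℝ θ z (V z) ∂μ ≤ ε := by
  set N : (E → ℝ) → ℝ := fun φ => ∫ z in Q, fderiv ℝ φ z (V z) ∂μ with hN
  set S : Set ℝ := N '' {φ | IsBumpFunction φ ∧ (∀ z, φ z ≤ Ξ z) ∧ tsupport φ ⊆ Q} with hS
  have hne : S.Nonempty := by
    refine ⟨_, fun _ => 0, ⟨⟨contDiff_const, ?_, fun _ => le_rfl⟩, hΞ.nonneg, ?_⟩, rfl⟩
    · exact HasCompactSupport.zero
    · simp [tsupport]
  -- `N φ = N Ξ - N (Ξ - φ)`, and `N (Ξ - φ)` is bounded below by `hbd`, which holds up to the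
  -- boundary.
  have hbdd : BddAbove S := by
    refine ⟨N Ξ + ∫ z, Ξ z ∂ν, ?_⟩
    rintro _ ⟨φ, ⟨hφ, hφΞ, -⟩, rfl⟩
    have hψ : IsBumpFunction fun z => Ξ z - φ z :=
      ⟨hΞ.contDiff.sub hφ.contDiff, hΞ.hasCompactSupport.sub hφ.hasCompactSupport,
        fun z => sub_nonneg.2 (hφΞ z)⟩
    have h1 := hbd _ hψ fun z => sub_le_self _ (hφ.nonneg z)
    have h2 := integral_fderiv_add (ν := μ.restrict Q) hφ hψ hV hVB
    have h3 : ∫ z, (Ξ z - φ z) ∂ν ≤ ∫ z, Ξ z ∂ν :=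
      integral_mono hψ.integrable hΞ.integrable fun z => sub_le_self _ (hφ.nonneg z)
    simp only [add_sub_cancel] at h2
    simp only [hN]
    linarith
  -- Take `K` to be the support of a near-maximizer `φ`. If `θ` is supported off `K`, then `θ + φ`
  -- still lies below `Ξ`, so `θ` can add at most `ε` to `N φ`.
  obtain ⟨_, ⟨φ, ⟨hφ, hφΞ, hφQ⟩, rfl⟩, hlt⟩ := exists_lt_of_lt_csSup hne (sub_lt_self (sSup S) hε)
  refine ⟨tsupport φ, hφQ, hφ.hasCompactSupport.isCompact, fun θ hθ hθΞ hθQ hdisj => ?_⟩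
  have hmem : N (fun z => θ z + φ z) ∈ S := by
    refine ⟨_, ⟨hθ.add hφ, fun z => ?_, ?_⟩, rfl⟩
    · by_cases hz : θ z = 0
      · simpa [hz] using hφΞ z
      · have : φ z = 0 := by
          by_contra hne
          exact disjoint_left.1 hdisj (subset_tsupport _ hz) (subset_tsupport _ hne)
        simpa [this] using hθΞ z
    · exact (tsupport_add θ φ).trans (union_subset hθQ hφQ)
  have h1 := le_csSup hbdd hmem
  have h2 : N (fun z => θ z + φ z) = N θ + N φ := integral_fderiv_add hθ hφ hV hVB
  change N θ ≤ ε
  linarith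

/-- Kato's inequality up to the boundary, for test functions supported where a one-sided kernel is
available and with an error term measured by `ν`. -/
theorem kato_of_kernel {Q U : Set E} (hQ : IsOpen Q) (hU : IsOpen U) {G : ℝ → E} {C : NNReal}
    {M : ℝ} (hGc : Continuous G) (hG : LipschitzOnWith C G (Icc (-M) M)) {u v : E → ℝ}
    (hu : Measurable u) (hv : Measurable v) (huM : ∀ z, u z ∈ Icc (-M) M)
    (hvM : ∀ z, v z ∈ Icc (-M) M) {k : ℝ} (hk : k ∈ Icc (-M) M)
    {ν : Measure E} [IsFiniteMeasureOnCompacts ν] {ξ : E → ℝ} (hξ : IsBumpFunction ξ)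
    (hξU : tsupport ξ ⊆ U)
    (hker : ∀ r > 0, ∃ ρ, IsBumpFunction ρ ∧ ∫ h, ρ h ∂μ = 1 ∧ tsupport ρ ⊆ Metric.closedBall 0 r ∧
      ∀ z ∈ tsupport ξ ∩ closure Q, ∀ h ∈ tsupport ρ, z + h ∈ Q)
    (husub : ∀ κ ∈ Icc k M, ∀ φ, IsBumpFunction φ → tsupport φ ⊆ U →
      0 ≤ ∫ z in Q, fderiv ℝ φ z (fluxJump G (u z) κ) ∂μ + ∫ z, φ z ∂ν)
    (hvsup : ∀ κ ∈ Icc (-M) k, ∀ φ, IsBumpFunction φ → tsupport φ ⊆ U →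
      0 ≤ ∫ z in Q, fderiv ℝ φ z (fluxJump G κ (v z)) ∂μ + ∫ z, φ z ∂ν)
    (huint : ∀ κ ∈ Icc (-M) M, ∀ φ, IsBumpFunction φ → tsupport φ ⊆ Q →
      0 ≤ ∫ z in Q, fderiv ℝ φ z (fluxJump G (u z) κ) ∂μ)
    (hvint : ∀ κ ∈ Icc (-M) M, ∀ φ, IsBumpFunction φ → tsupport φ ⊆ Q →
      0 ≤ ∫ z in Q, fderiv ℝ φ z (fluxJump G κ (v z)) ∂μ) :
    0 ≤ ∫ z in Q, fderiv ℝ ξ z (fluxJump G (u z) (v z)) ∂μ + 2 * ∫ z, ξ z ∂ν := by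
  have hQm := hQ.measurableSet
  have hJ := continuous_fluxJump hGc
  have hJB : ∀ a ∈ Icc (-M) M, ∀ b ∈ Icc (-M) M, ‖fluxJump G a b‖ ≤ 2 * C * (2 * M) := by
    intro a ha b hb
    refine (norm_fluxJump_le hG ha hb).trans ?_
    have : |b - a| ≤ 2 * M := by rw [abs_le]; constructor <;> linarith [ha.1, ha.2, hb.1, hb.2]
    gcongr
  have hM : -M ≤ M := hk.1.trans hk.2
  -- The five errors are three translation errors (one per doubling) and two defects.
  suffices h : ∀ ε > 0, 0 ≤ ∫ z in Q, fderiv ℝ ξ z (fluxJump G (u z) (v z)) ∂μ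
      + 2 * ∫ z, ξ z ∂ν + 5 * ε by
    refine le_of_forall_pos_le_add fun ε hε => ?_
    have := h (ε / 5) (by positivity)
    linarith
  intro ε hε
  obtain ⟨B, hB⟩ := hξ.contDiff.continuous.bounded_above_of_compact_support hξ.hasCompactSupport
  have hξB : ∀ z, ξ z ≤ B := fun z => (Real.le_norm_self _).trans (hB z)
  have hB0 : 0 ≤ B := (hξ.nonneg 0).trans (hξB 0)
  -- an upper barrier for the mollified test functions
  obtain ⟨χ₀, δ₀, hδ₀, hχ₀, -, hχ₀U, hχ₀1⟩ :=
    exists_cutoff hξ.hasCompactSupport.isCompact hU hξU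
  have hΞ : IsBumpFunction fun z => χ₀ z * B := hχ₀.mul contDiff_const fun _ => hB0
  have hΞU : ∀ φ : E → ℝ, IsBumpFunction φ → (∀ z, φ z ≤ χ₀ z * B) → tsupport φ ⊆ U := by
    intro φ hφ hle
    refine (closure_mono fun z hz => ?_).trans hχ₀U
    intro h0
    have := hle z
    rw [h0, zero_mul] at this
    exact hz (le_antisymm this (hφ.nonneg z))
  have hV1m : Measurable fun z => fluxJump G k (v z) :=
    hJ.measurable.comp (measurable_const.prodMk hv)
  have hV2m : Measurable fun z => fluxJump G (u z) k :=
    hJ.measurable.comp (hu.prodMk measurable_const)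
  -- `K₁` controls the remainder `fluxJump G k v` of the doubling above `k`, and `K₂` the remainder
  -- `fluxJump G u k` of the reflected doubling below `k`.
  obtain ⟨K₁, hK₁Q, hK₁, hdef₁⟩ := exists_compact_small_defect (μ := μ) (Q := Q) (ν := ν) hV1m
    (fun z => hJB _ hk _ (hvM z)) hΞ
    (fun φ hφ hle => hvsup k ⟨hk.1, le_rfl⟩ φ hφ (hΞU φ hφ hle)) hε
  obtain ⟨K₂, hK₂Q, hK₂, hdef₂⟩ := exists_compact_small_defect (μ := μ) (Q := Q) (ν := ν) hV2m
    (fun z => hJB _ (huM z) _ hk) hΞ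
    (fun φ hφ hle => husub k ⟨le_rfl, hk.2⟩ φ hφ (hΞU φ hφ hle)) hε
  obtain ⟨χ, δ, hδ, hχ, hχ1, hχQ, hχK⟩ :=
    exists_cutoff (hK₁.union hK₂) hQ (union_subset hK₁Q hK₂Q)
  -- `ξa` is supported in `Q` and needs only the interior inequalities; `ξb` reaches the boundary
  -- but stays at distance `δ` from `K₁ ∪ K₂`.
  set ξa : E → ℝ := fun z => ξ z * χ z with hξa_def
  set ξb : E → ℝ := fun z => ξ z * (1 - χ z) with hξb_def
  have hξa : IsBumpFunction ξa := hξ.mul hχ.contDiff hχ.nonneg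
  have hξb : IsBumpFunction ξb :=
    hξ.mul (contDiff_const.sub hχ.contDiff) fun z => sub_nonneg.2 (hχ1 z)
  have hξab : (fun z => ξa z + ξb z) = ξ := by ext z; simp only [hξa_def, hξb_def]; ring
  have hξaξ : tsupport ξa ⊆ tsupport ξ := tsupport_mul_subset_left' ξ χ
  have hξbξ : tsupport ξb ⊆ tsupport ξ := tsupport_mul_subset_left' ξ fun z => 1 - χ z
  have hξaQ : tsupport ξa ⊆ Q := (tsupport_mul_subset_right' ξ χ).trans hχQ
  have hξbB : ∀ z, ξb z ≤ B := fun z => by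
    refine le_trans ?_ (hξB z)
    exact mul_le_of_le_one_right (hξ.nonneg z) (sub_le_self _ (hχ.nonneg z))
  have hξbK : ∀ z ∈ tsupport ξb, z ∉ Metric.thickening δ (K₁ ∪ K₂) := by
    have : tsupport ξb ⊆ (Metric.thickening δ (K₁ ∪ K₂))ᶜ := by
      refine closure_minimal (fun z hz hzK => hz ?_) Metric.isOpen_thickening.isClosed_compl
      simp [hξb_def, hχK z (Metric.thickening_subset_cthickening _ _ hzK)]
    exact this
  -- the reflected problem
  set G' : ℝ → E := fun s => -G (-s) with hG'
  have hneg : ∀ a ∈ Icc (-M) M, -a ∈ Icc (-M) M := fun a ha =>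
    ⟨by linarith [ha.2], by linarith [ha.1]⟩
  have hG'c : Continuous G' := (hGc.comp continuous_neg).neg
  have hG'L : LipschitzOnWith C G' (Icc (-M) M) := by
    refine LipschitzOnWith.of_dist_le_mul fun x hx y hy => ?_
    have := hG.dist_le_mul _ (hneg x hx) _ (hneg y hy)
    rwa [dist_neg_neg] at this ⊢
  -- choice of the kernel
  have ev1 := eventually_translate_le (μ := μ) (Q := Q) hGc hG hu hv huM hvM
    (k := -M) ⟨le_rfl, hM⟩ hξa hε
  have ev2 := eventually_translate_le (μ := μ) (Q := Q) hGc hG hu hv huM hvM hk hξb hε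
  have ev3 := eventually_translate_le (μ := μ) (Q := Q) hG'c hG'L hv.neg hu.neg
    (fun z => hneg _ (hvM z)) (fun z => hneg _ (huM z)) (hneg k hk) hξb hε
  obtain ⟨r₀, hr₀, hball⟩ := Metric.eventually_nhds_iff_ball.1 (ev1.and (ev2.and ev3))
  -- `r < r₀` makes the translation errors at most `ε`, `r ≤ δ₀` keeps the mollification of `ξb`
  -- below the barrier, and `r ≤ δ / 2` keeps its support off `K₁ ∪ K₂`.
  set r := min (r₀ / 2) (min δ₀ (δ / 2)) with hr
  have hrpos : 0 < r := by positivity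
  obtain ⟨ρ, hρ, hρ1, hρr, hshift⟩ := hker r hrpos
  have hρball : ∀ h ∈ tsupport ρ, h ∈ Metric.ball 0 r₀ := fun h hh =>
    Metric.closedBall_subset_ball (by linarith [min_le_left (r₀ / 2) (min δ₀ (δ / 2))]) (hρr hh)
  have hshifta : ∀ z ∈ tsupport ξa ∩ closure Q, ∀ h ∈ tsupport ρ, z + h ∈ Q := fun z hz =>
    hshift z ⟨hξaξ hz.1, hz.2⟩
  have hshiftb : ∀ z ∈ tsupport ξb ∩ closure Q, ∀ h ∈ tsupport ρ, z + h ∈ Q := fun z hz =>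
    hshift z ⟨hξbξ hz.1, hz.2⟩
  -- the mollified test function is small in the sense of the defect measures
  have hθ : IsBumpFunction (mollify μ Q ξb ρ) := isBumpFunction_mollify hQm hξb hρ
  have hθΞ : ∀ z, mollify μ Q ξb ρ z ≤ χ₀ z * B := by
    intro z'
    by_cases h0 : mollify μ Q ξb ρ z' = 0
    · rw [h0]
      exact hΞ.nonneg z'
    · obtain ⟨z, -, h1, h2⟩ := exists_of_mollify_ne_zero h0
      have hz' : z' ∈ Metric.cthickening δ₀ (tsupport ξ) := by
        refine Metric.mem_cthickening_of_dist_le z' z _ _ (hξbξ (subset_tsupport _ h1)) ?_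
        have := hρr (subset_tsupport _ h2)
        rw [mem_closedBall_zero_iff] at this
        rw [dist_eq_norm]
        exact this.trans ((min_le_right _ _).trans (min_le_left _ _))
      rw [hχ₀1 z' hz', one_mul]
      exact mollify_le hξb hρ hρ1 hξbB z'
  have hθQ : tsupport (mollify μ Q ξb ρ) ⊆ Q := by
    intro z' hz'
    obtain ⟨⟨z, h⟩, ⟨h1, h2⟩, rfl⟩ := tsupport_mollify_subset hξb hρ hz'
    exact hshiftb z h1 h h2
  have hθK : Disjoint (tsupport (mollify μ Q ξb ρ)) (K₁ ∪ K₂) := by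
    rw [disjoint_left]
    intro z' hz' hK
    obtain ⟨⟨z, h⟩, ⟨h1, h2⟩, rfl⟩ := tsupport_mollify_subset hξb hρ hz'
    refine hξbK z h1.1 (Metric.mem_thickening_iff.2 ⟨_, hK, ?_⟩)
    have := hρr h2
    rw [mem_closedBall_zero_iff] at this
    have h3 : r ≤ δ / 2 := (min_le_right _ _).trans (min_le_right _ _)
    rw [dist_eq_norm]
    simp only [sub_add_cancel_left, norm_neg]
    linarith
  have hd₁ := hdef₁ _ hθ hθΞ hθQ (hθK.mono_right subset_union_left)
  have hd₂ := hdef₂ _ hθ hθΞ hθQ (hθK.mono_right subset_union_right)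
  -- the interior part
  have hA := doubling_variables (μ := μ) hQm hGc hG hu hv huM hvM (k := -M) ⟨le_rfl, hM⟩
    (ν := 0) hξa hρ hρ1 hshifta
    (fun κ hκ φ hφ hφξ => by simpa using huint κ hκ φ hφ (hφξ.trans hξaQ)) hvint
    fun h hh => (hball h (hρball h hh)).1
  -- Since `v ≥ -M`, cutting at the level `-M` has no effect and leaves no remainder.
  have hmaxM : ∀ z, max (v z) (-M) = v z := fun z => max_eq_left (hvM z).1
  simp only [hmaxM, fluxJump_of_le (hvM _).1, map_zero, integral_zero, integral_zero_measure,
    add_zero] at hA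
  -- the boundary layer, above and below the level `k`
  have hB1 := doubling_variables (μ := μ) hQm hGc hG hu hv huM hvM hk
    (ν := ν) hξb hρ hρ1 hshiftb
    (fun κ hκ φ hφ hφξ => husub κ hκ φ hφ (hφξ.trans (hξbξ.trans hξU))) hvint
    fun h hh => (hball h (hρball h hh)).2.1
  -- The reflection exchanges the roles: `v` is now tested up to the boundary, at levels at most
  -- `k`, and `u` only in the interior.
  have hB2 := doubling_variables (μ := μ) hQm hG'c hG'L hv.neg hu.neg
    (fun z => hneg _ (hvM z)) (fun z => hneg _ (huM z)) (hneg k hk)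
    (ν := ν) hξb hρ hρ1 hshiftb
    (fun κ hκ φ hφ hφξ => by
      have := hvsup (-κ) ⟨by linarith [hκ.2], by linarith [hκ.1]⟩ φ hφ (hφξ.trans (hξbξ.trans hξU))
      simpa [hG', fluxJump_neg'] using this)
    (fun κ hκ φ hφ hφQ => by
      have := huint (-κ) (hneg κ hκ) φ hφ hφQ
      simpa [hG', fluxJump_neg'] using this)
    fun h hh => (hball h (hρball h hh)).2.2
  simp only [hG', fluxJump_neg', Pi.neg_apply, neg_neg, max_neg_neg] at hB2
  have i1 : Integrable (fun z => fderiv ℝ ξb z (fluxJump G (u z) (max (v z) k)))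
      (μ.restrict Q) := hξb.integrable_fderiv
    (hJ.measurable.comp (hu.prodMk (hv.max measurable_const))) fun z => hJB _ (huM z) _
      ⟨(hvM z).1.trans (le_max_left _ _), max_le (hvM z).2 hk.2⟩
  have i2 : Integrable (fun z => fderiv ℝ ξb z (fluxJump G (min (u z) k) (v z)))
      (μ.restrict Q) := hξb.integrable_fderiv
    (hJ.measurable.comp ((hu.min measurable_const).prodMk hv)) fun z => hJB _
      ⟨le_min (huM z).1 hk.1, (min_le_left _ _).trans (huM z).2⟩ _ (hvM z)
  have hsum : ∫ z in Q, fderiv ℝ ξb z (fluxJump G (u z) (max (v z) k)) ∂μ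
      + ∫ z in Q, fderiv ℝ ξb z (fluxJump G (min (u z) k) (v z)) ∂μ
      = ∫ z in Q, fderiv ℝ ξb z (fluxJump G (u z) (v z)) ∂μ := by
    rw [← integral_add i1 i2]
    simp only [← map_add, fluxJump_sup_add_inf]
  have htot : ∫ z in Q, fderiv ℝ ξ z (fluxJump G (u z) (v z)) ∂μ
      = ∫ z in Q, fderiv ℝ ξa z (fluxJump G (u z) (v z)) ∂μ
        + ∫ z in Q, fderiv ℝ ξb z (fluxJump G (u z) (v z)) ∂μ := by
    conv_lhs => rw [← hξab]
    exact integral_fderiv_add hξa hξb (hJ.measurable.comp (hu.prodMk hv))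
      fun z => hJB _ (huM z) _ (hvM z)
  have hν : ∫ z, ξb z ∂ν ≤ ∫ z, ξ z ∂ν := integral_mono hξb.integrable hξ.integrable fun z =>
    mul_le_of_le_one_right (hξ.nonneg z) (sub_le_self _ (hχ.nonneg z))
  linarith

end LocalKato

/-! ### Geometry of `C²` domains: interior cones and surface measure -/

section Boundary

variable {d : ℕ}

theorem inner_gradient_eq_fderiv {V : Type*} [NormedAddCommGroup V] [InnerProductSpace ℝ V]
    [CompleteSpace V] (ρ : V → ℝ) (x w : V) : inner ℝ (gradient ρ x) w = fderiv ℝ ρ x w := by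
  rw [← InnerProductSpace.toDual_apply_apply, toDual_gradient]

theorem norm_outerUnitNormal_le (Ω : Set (Space d)) (x : Space d) : ‖outerUnitNormal Ω x‖ ≤ 1 := by
  unfold outerUnitNormal
  split_ifs with h
  · rw [norm_smul, norm_inv, norm_norm]
    exact inv_mul_le_one
  · simp

/-- Near a boundary point, a defining function is well approximated by its differential. -/
theorem exists_ball_defining {Ω : Set (Space d)} {x₀ : Space d} {ρ : Space d → ℝ}
    (hρ : IsC2DefiningFunctionAt Ω x₀ ρ) : ∃ r > 0,
      (∀ x ∈ Metric.ball x₀ r, ∀ y ∈ Metric.ball x₀ r,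
        |ρ x - ρ y - inner ℝ (gradient ρ x₀) (x - y)| ≤ ‖gradient ρ x₀‖ / 4 * ‖x - y‖) ∧
      (∀ x ∈ Metric.ball x₀ r, (x ∈ Ω ↔ ρ x < 0)) ∧
      ∀ x ∈ Metric.ball x₀ r, ContinuousAt ρ x := by
  obtain ⟨h1, h2, h3⟩ := hρ
  have hg : 0 < ‖gradient ρ x₀‖ / 4 := by positivity
  have e1 := (h1.hasStrictFDerivAt (by simp)).isLittleO.def hg
  have e2 := h1.eventually (by simp)
  rw [nhds_prod_eq] at e1
  obtain ⟨t, ht, hb₁⟩ := eventually_prod_self_iff'.1 e1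
  obtain ⟨r₁, hr₁, hrt⟩ := Metric.mem_nhds_iff.1 ht
  obtain ⟨r₂, hr₂, hb₂⟩ := Metric.eventually_nhds_iff_ball.1 (h3.and e2)
  refine ⟨min r₁ r₂, by positivity, fun x hx y hy => ?_, fun x hx => ?_, fun x hx => ?_⟩
  · have := hb₁ x (hrt (Metric.ball_subset_ball (min_le_left _ _) hx)) y
      (hrt (Metric.ball_subset_ball (min_le_left _ _) hy))
    simpa [inner_gradient_eq_fderiv] using this
  · exact (hb₂ x (Metric.ball_subset_ball (min_le_right _ _) hx)).1
  · exact (hb₂ x (Metric.ball_subset_ball (min_le_right _ _) hx)).2.continuousAt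

/-- A `C²` domain has the uniform interior cone property locally. -/
theorem IsC2Domain.exists_cone {Ω : Set (Space d)} (hΩ : IsC2Domain Ω) (x₀ : Space d) :
    ∃ e : Space d, ∃ κ > 0, ∃ δ > 0, ∀ x ∈ closure Ω ∩ Metric.ball x₀ δ, ∀ τ, 0 < τ → τ ≤ δ →
      ∀ h, ‖h - τ • e‖ ≤ κ * τ → x + h ∈ Ω := by
  by_cases hx₀ : x₀ ∈ frontier Ω
  · obtain ⟨ρ, hρ⟩ := hΩ.2 x₀ hx₀
    obtain ⟨r, hr, happ, hiff, hcont⟩ := exists_ball_defining hρ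
    set g := gradient ρ x₀ with hg
    have hg0 : 0 < ‖g‖ := norm_pos_iff.2 hρ.2.1
    -- With these constants `⟨g, h⟩ ≤ -(3/4) ‖g‖² τ`, while the linearization error is at most
    -- `(5/16) ‖g‖² τ`; hence `ρ (x + h) < 0`. The choice of `δ` gives `‖x - x₀‖ < r / 2` and `‖h‖ ≤
    -- (5/16) r`, so `x + h` stays in the ball.
    refine ⟨-g, ‖g‖ / 4, by positivity, min (r / 2) (r / (4 * ‖g‖)), by positivity, ?_⟩
    rintro x ⟨hxΩ, hx⟩ τ hτ hτδ h hh
    have hx2 : dist x x₀ < r / 2 := lt_of_lt_of_le hx (min_le_left _ _)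
    have hxr : x ∈ Metric.ball x₀ r := by rw [Metric.mem_ball]; linarith
    have hρx : ρ x ≤ 0 := by
      by_contra! hpos
      have e1 : ∀ᶠ y in 𝓝 x, 0 < ρ y := (hcont x hxr).eventually (lt_mem_nhds hpos)
      have e2 : ∀ᶠ y in 𝓝 x, y ∈ Metric.ball x₀ r := Metric.isOpen_ball.mem_nhds hxr
      obtain ⟨y, hyΩ, hy1, hy2⟩ :=
        ((mem_closure_iff_frequently.1 hxΩ).and_eventually (e1.and e2)).exists
      exact absurd ((hiff y hy2).1 hyΩ) (not_lt.2 hy1.le)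
    have hhn : ‖h‖ ≤ 5 / 4 * ‖g‖ * τ := by
      calc ‖h‖ = ‖(h - τ • -g) + τ • -g‖ := by rw [sub_add_cancel]
        _ ≤ ‖h - τ • -g‖ + ‖τ • -g‖ := norm_add_le _ _
        _ ≤ ‖g‖ / 4 * τ + τ * ‖g‖ := by
            rw [norm_smul, norm_neg, Real.norm_of_nonneg hτ.le]; gcongr
        _ = _ := by ring
    have hτ2 : τ * (4 * ‖g‖) ≤ r := (le_div_iff₀ (by positivity)).1 (hτδ.trans (min_le_right _ _))
    have hyr : x + h ∈ Metric.ball x₀ r := by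
      rw [mem_ball_iff_norm]
      calc ‖x + h - x₀‖ = ‖(x - x₀) + h‖ := by congr 1; abel
        _ ≤ ‖x - x₀‖ + ‖h‖ := norm_add_le _ _
        _ < r := by rw [← dist_eq_norm]; nlinarith
    have h1 := happ (x + h) hyr x hxr
    rw [add_sub_cancel_left] at h1
    have h2 : inner ℝ g h ≤ -(3 / 4) * ‖g‖ ^ 2 * τ := by
      have e1 : inner ℝ g h = inner ℝ g (h - τ • -g) - τ * ‖g‖ ^ 2 := by
        rw [inner_sub_right, inner_smul_right, inner_neg_right, real_inner_self_eq_norm_sq]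
        ring
      have e2 : inner ℝ g (h - τ • -g) ≤ ‖g‖ * (‖g‖ / 4 * τ) :=
        (real_inner_le_norm _ _).trans (by gcongr)
      rw [e1]
      nlinarith
    have h3 := (abs_le.1 h1).2
    have h4 : ‖g‖ / 4 * ‖h‖ ≤ ‖g‖ / 4 * (5 / 4 * ‖g‖ * τ) := by gcongr
    rw [hiff _ hyr]
    have h5 : 0 < ‖g‖ ^ 2 * τ := by positivity
    nlinarith
  · have hcl : IsClosed (frontier Ω) := isClosed_frontier
    obtain ⟨r, hr, hball⟩ := Metric.isOpen_iff.1 hcl.isOpen_compl x₀ hx₀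
    by_cases hxΩ : x₀ ∈ Ω
    · obtain ⟨s, hs, hsΩ⟩ := Metric.isOpen_iff.1 hΩ.1 x₀ hxΩ
      refine ⟨0, 1, one_pos, s / 2, by positivity, ?_⟩
      rintro x ⟨-, hx⟩ τ hτ hτδ h hh
      refine hsΩ ?_
      rw [mem_ball_iff_norm] at hx ⊢
      rw [smul_zero, sub_zero, one_mul] at hh
      calc ‖x + h - x₀‖ = ‖(x - x₀) + h‖ := by congr 1; abel
        _ ≤ ‖x - x₀‖ + ‖h‖ := norm_add_le _ _
        _ < s := by linarith
    · have hx₀c : x₀ ∈ (closure Ω)ᶜ := by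
        intro h
        exact hx₀ ⟨h, by rwa [hΩ.1.interior_eq]⟩
      obtain ⟨s, hs, hsΩ⟩ := Metric.isOpen_iff.1 isClosed_closure.isOpen_compl x₀ hx₀c
      exact ⟨0, 1, one_pos, s, hs, fun x hx => absurd hx.1 (hsΩ hx.2)⟩

/-- Differences of points of `A` have at most a quarter of their length along `g`, so the projection
to the hyperplane `g^⊥` contracts distances at most by the factor 2. The measure of `A` is thus
controlled by that of a bounded set in dimension `n`. -/
theorem hausdorffMeasure_lt_top_of_nearly_flat {V : Type*} [NormedAddCommGroup V]
    [InnerProductSpace ℝ V] [FiniteDimensional ℝ V] [MeasurableSpace V] [BorelSpace V] {n : ℕ}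
    (hn : Module.finrank ℝ V = n + 1) {g : V} (hg : g ≠ 0) {A : Set V}
    (hA : Bornology.IsBounded A)
    (hflat : ∀ x ∈ A, ∀ y ∈ A, |inner ℝ g (x - y)| ≤ ‖g‖ / 4 * ‖x - y‖) :
    Measure.hausdorffMeasure (n : ℝ) A < ⊤ := by
  set S : Submodule ℝ V := Submodule.span ℝ {g} with hS
  have : Fact (Module.finrank ℝ V = n + 1) := ⟨hn⟩
  have hdim : Module.finrank ℝ Sᗮ = n := Submodule.finrank_orthogonal_span_singleton hg
  have hg0 : 0 < ‖g‖ := norm_pos_iff.2 hg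
  set p : A → Sᗮ := fun x => Sᗮ.orthogonalProjectionOnto x.1 with hp
  have hanti : AntilipschitzWith 2 p := by
    refine AntilipschitzWith.of_le_mul_dist fun x y => ?_
    rw [Subtype.dist_eq, dist_eq_norm, dist_eq_norm]
    have h1 : p x - p y = Sᗮ.orthogonalProjectionOnto (x.1 - y.1) := by rw [map_sub]
    have h2 := Submodule.norm_sq_eq_add_norm_sq_projection (𝕜 := ℝ) (x.1 - y.1) S
    have h3 : ‖S.orthogonalProjectionOnto (x.1 - y.1)‖ ≤ 1 / 4 * ‖x.1 - y.1‖ := by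
      have e1 : ‖S.orthogonalProjectionOnto (x.1 - y.1)‖
          = ‖(Submodule.span ℝ {g}).starProjection (x.1 - y.1)‖ := rfl
      rw [e1, Submodule.starProjection_singleton, norm_smul]
      simp only [RCLike.ofReal_real_eq_id, id_eq, norm_div, Real.norm_eq_abs, abs_pow, abs_norm]
      have := hflat x.1 x.2 y.1 y.2
      calc |inner ℝ g (x.1 - y.1)| / ‖g‖ ^ 2 * ‖g‖ = |inner ℝ g (x.1 - y.1)| / ‖g‖ := by
            field_simp
        _ ≤ (‖g‖ / 4 * ‖x.1 - y.1‖) / ‖g‖ := by gcongr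
        _ = 1 / 4 * ‖x.1 - y.1‖ := by field_simp
    rw [h1]
    have h4 : ‖S.orthogonalProjectionOnto (x.1 - y.1)‖ ^ 2 ≤ (1 / 4 * ‖x.1 - y.1‖) ^ 2 := by gcongr
    have h5 : (0 : ℝ) ≤ 2 * ‖Sᗮ.orthogonalProjectionOnto (x.1 - y.1)‖ := by positivity
    refine le_trans (abs_le_of_sq_le_sq ?_ h5 |> (le_abs_self _).trans) ?_
    · nlinarith [sq_nonneg ‖x.1 - y.1‖]
    · norm_num
  have hiso : Measure.hausdorffMeasure (n : ℝ) A
      = Measure.hausdorffMeasure (n : ℝ) (univ : Set A) := by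
    have := (isometry_subtype_coe (s := A)).hausdorffMeasure_image
      (Or.inl (Nat.cast_nonneg n)) univ
    rwa [image_univ, Subtype.range_coe] at this
  rw [hiso]
  refine (hanti.le_hausdorffMeasure_image (Nat.cast_nonneg n) univ).trans_lt ?_
  refine ENNReal.mul_lt_top (ENNReal.rpow_lt_top_of_nonneg (Nat.cast_nonneg n) (by simp)) ?_
  have hb : Bornology.IsBounded (p '' univ) := by
    have : p '' univ = Sᗮ.orthogonalProjectionOnto '' A := by
      ext y
      simp [hp]
    rw [this]
    exact (Sᗮ.orthogonalProjectionOnto.lipschitz).isBounded_image hA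
  rw [← hdim]
  exact hb.measure_lt_top

theorem isFiniteMeasureOnCompacts_surfaceMeasure (hd : 1 ≤ d) {Ω : Set (Space d)}
    (hΩ : IsC2Domain Ω) : IsFiniteMeasureOnCompacts (surfaceMeasure Ω) := by
  have hcl : IsClosed (frontier Ω) := isClosed_frontier
  have : IsLocallyFiniteMeasure (surfaceMeasure Ω) := by
    refine ⟨fun x₀ => ?_⟩
    by_cases hx₀ : x₀ ∈ frontier Ω
    · obtain ⟨ρ, hρ⟩ := hΩ.2 x₀ hx₀
      obtain ⟨r, hr, happ, hiff, hcont⟩ := exists_ball_defining hρ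
      refine ⟨Metric.ball x₀ r, Metric.ball_mem_nhds _ hr, ?_⟩
      rw [surfaceMeasure, Measure.restrict_apply Metric.isOpen_ball.measurableSet,
        Measure.euclideanHausdorffMeasure_def, Measure.smul_apply]
      refine ENNReal.mul_lt_top ENNReal.coe_lt_top ?_
      -- On the boundary `ρ` vanishes, which turns the linearization estimate into the flatness
      -- hypothesis.
      have hzero : ∀ x ∈ Metric.ball x₀ r ∩ frontier Ω, ρ x = 0 := by
        rintro x ⟨hxr, hx⟩
        have e2 : ∀ᶠ y in 𝓝 x, y ∈ Metric.ball x₀ r := Metric.isOpen_ball.mem_nhds hxr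
        refine le_antisymm ?_ ?_
        · by_contra! hpos
          have e1 : ∀ᶠ y in 𝓝 x, 0 < ρ y := (hcont x hxr).eventually (lt_mem_nhds hpos)
          obtain ⟨y, hyΩ, hy1, hy2⟩ := ((mem_closure_iff_frequently.1
            (frontier_subset_closure hx)).and_eventually (e1.and e2)).exists
          exact absurd ((hiff y hy2).1 hyΩ) (not_lt.2 hy1.le)
        · by_contra! hneg
          have hxΩ := (hiff x hxr).2 hneg
          rw [hΩ.1.frontier_eq] at hx
          exact hx.2 hxΩ
      refine hausdorffMeasure_lt_top_of_nearly_flat (g := gradient ρ x₀) ?_ hρ.2.1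
        (Metric.isBounded_ball.subset inter_subset_left) fun x hx y hy => ?_
      · rw [finrank_euclideanSpace_fin]
        omega
      · have := happ x hx.1 y hy.1
        rwa [hzero x hx, hzero y hy, sub_self, zero_sub, abs_neg] at this
    · refine ⟨(frontier Ω)ᶜ, hcl.isOpen_compl.mem_nhds hx₀, ?_⟩
      rw [surfaceMeasure, Measure.restrict_apply hcl.isOpen_compl.measurableSet]
      simp
  infer_instance

end Boundary

/-! ### One-sided kernels from interior cones -/

section Kernels

variable {d : ℕ}

/-- Every point of `(0,∞) × ℝ^d` has a neighbourhood in which one-sided kernels are available. -/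
theorem IsC2Domain.exists_kernel {Ω : Set (Space d)} (hΩ : IsC2Domain Ω) {z₀ : ℝ × Space d}
    (hz₀ : 0 < z₀.1) : ∃ W, IsOpen W ∧ z₀ ∈ W ∧ ∀ r > 0, ∃ ρ : ℝ × Space d → ℝ,
      IsBumpFunction ρ ∧ ∫ h, ρ h = 1 ∧ tsupport ρ ⊆ Metric.closedBall 0 r ∧
      ∀ z ∈ W ∩ closure (Ioi 0 ×ˢ Ω), ∀ h ∈ tsupport ρ, z + h ∈ Ioi (0 : ℝ) ×ˢ Ω := by
  obtain ⟨e, κ, hκ, δ, hδ, hcone⟩ := hΩ.exists_cone z₀.2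
  refine ⟨Ioi (z₀.1 / 2) ×ˢ Metric.ball z₀.2 δ, isOpen_Ioi.prod Metric.isOpen_ball,
    ⟨by simp only [mem_Ioi]; linarith, Metric.mem_ball_self hδ⟩, fun r hr => ?_⟩
  have hpos : 0 < ‖e‖ + κ := by positivity
  -- The kernel lives in the ball of radius `κ τ` about `(0, τ e)`. The three bounds on `τ` make the
  -- cone property apply, place this ball within `r` of the origin, and keep the time shift at most
  -- `z₀.1 / 2`.
  set τ := min δ (min (r / (‖e‖ + κ)) (z₀.1 / (2 * κ))) with hτ
  have hτ0 : 0 < τ := by positivity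
  have hτr : τ * (‖e‖ + κ) ≤ r := (le_div_iff₀ hpos).1 ((min_le_right _ _).trans (min_le_left _ _))
  have hτz : τ * (2 * κ) ≤ z₀.1 :=
    (le_div_iff₀ (by positivity)).1 ((min_le_right _ _).trans (min_le_right _ _))
  let φ : ContDiffBump (((0 : ℝ), τ • e) : ℝ × Space d) :=
    ⟨κ * τ / 2, κ * τ, by positivity, by linarith [mul_pos hκ hτ0]⟩
  have hts : tsupport (φ.normed volume) = Metric.closedBall ((0 : ℝ), τ • e) (κ * τ) :=
    φ.tsupport_normed_eq
  refine ⟨φ.normed volume, ⟨φ.contDiff_normed, φ.hasCompactSupport_normed, φ.nonneg_normed⟩,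
    φ.integral_normed, ?_, ?_⟩
  · rw [hts]
    refine Metric.closedBall_subset_closedBall' ?_
    rw [dist_zero_right, Prod.norm_def, norm_zero, norm_smul, Real.norm_of_nonneg hτ0.le,
      max_eq_right (by positivity)]
    linarith
  · rintro z ⟨⟨hz1, hz2⟩, hzc⟩ h hh
    rw [hts, mem_closedBall_iff_norm, Prod.norm_def, max_le_iff] at hh
    rw [closure_prod_eq] at hzc
    refine ⟨?_, hcone z.2 ⟨hzc.2, hz2⟩ τ hτ0 (min_le_left _ _) h.2 hh.2⟩
    have h1 := (abs_le.1 (by simpa using hh.1)).1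
    simp only [mem_Ioi, Prod.fst_add] at hz1 ⊢
    linarith

end Kernels

/-- A compactly supported bump function is a finite sum of bump functions subordinate to an open
cover of its support. -/
theorem IsBumpFunction.exists_partition {E : Type*} [NormedAddCommGroup E] [NormedSpace ℝ E]
    [FiniteDimensional ℝ E] {ι : Type*} {ξ : E → ℝ} (hξ : IsBumpFunction ξ)
    {W : ι → Set E} (hW : ∀ i, IsOpen (W i)) (hcov : tsupport ξ ⊆ ⋃ i, W i) :
    ∃ (T : Finset ι) (η : ι → E → ℝ), (∀ i, IsBumpFunction (η i)) ∧
      (∀ i, tsupport (η i) ⊆ tsupport ξ ∩ W i) ∧ ∀ z, ∑ i ∈ T, η i z = ξ z := by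
  obtain ⟨f, hf⟩ := SmoothPartitionOfUnity.exists_isSubordinate (modelWithCornersSelf ℝ E)
    (isClosed_tsupport ξ) W hW hcov
  have hfin := f.locallyFinite.finite_nonempty_inter_compact hξ.hasCompactSupport.isCompact
  refine ⟨hfin.toFinset, fun i z => ξ z * f i z, fun i =>
    hξ.mul (f i).contMDiff.contDiff fun z => f.nonneg i z, fun i => subset_inter
    (tsupport_mul_subset_left' _ _) ((tsupport_mul_subset_right' _ _).trans (hf i)), fun z => ?_⟩
  by_cases hz : z ∈ tsupport ξ
  · rw [← Finset.mul_sum, ← finsum_eq_sum_of_support_subset, f.sum_eq_one hz, mul_one]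
    intro i hi
    rw [hfin.coe_toFinset]
    exact ⟨z, hi, hz⟩
  · have : ξ z = 0 := image_eq_zero_of_notMem_tsupport hz
    simp [this]

/-! ### Kato's inequality with a variable boundary datum -/

section GlobalKato

variable {E : Type*} [NormedAddCommGroup E] [NormedSpace ℝ E] [FiniteDimensional ℝ E]
  [MeasurableSpace E] [BorelSpace E] {μ : Measure E} [μ.IsAddHaarMeasure]

/-- Kato's inequality up to the boundary for two entropy solutions with the same boundary datum
`a`. The measure `m` carries the boundary terms. -/
theorem kato_inequality {Q U : Set E} (hQ : IsOpen Q) (hU : IsOpen U) {G : ℝ → E} {C : NNReal}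
    {M : ℝ} (hGc : Continuous G) (hG : LipschitzOnWith C G (Icc (-M) M)) {u v : E → ℝ}
    (hu : Measurable u) (hv : Measurable v) (huM : ∀ z, u z ∈ Icc (-M) M)
    (hvM : ∀ z, v z ∈ Icc (-M) M) {m : Measure E} [IsFiniteMeasureOnCompacts m] {a : E → ℝ}
    (ha : Measurable a) (haM : ∀ z, a z ∈ Icc (-M) M) {D : ℝ} (hD : 0 ≤ D)
    (hker : ∀ z₀ ∈ U, ∃ W, IsOpen W ∧ z₀ ∈ W ∧ ∀ r > 0, ∃ ρ, IsBumpFunction ρ ∧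
      ∫ h, ρ h ∂μ = 1 ∧ tsupport ρ ⊆ Metric.closedBall 0 r ∧
      ∀ z ∈ W ∩ closure Q, ∀ h ∈ tsupport ρ, z + h ∈ Q)
    (husub : ∀ k ∈ Icc (-M) M, ∀ κ ∈ Icc k M, ∀ φ, IsBumpFunction φ → tsupport φ ⊆ U →
      0 ≤ ∫ z in Q, fderiv ℝ φ z (fluxJump G (u z) κ) ∂μ + ∫ z, φ z * (D * |a z - k|) ∂m)
    (hvsup : ∀ k ∈ Icc (-M) M, ∀ κ ∈ Icc (-M) k, ∀ φ, IsBumpFunction φ → tsupport φ ⊆ U →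
      0 ≤ ∫ z in Q, fderiv ℝ φ z (fluxJump G κ (v z)) ∂μ + ∫ z, φ z * (D * |a z - k|) ∂m)
    (huint : ∀ κ ∈ Icc (-M) M, ∀ φ, IsBumpFunction φ → tsupport φ ⊆ Q →
      0 ≤ ∫ z in Q, fderiv ℝ φ z (fluxJump G (u z) κ) ∂μ)
    (hvint : ∀ κ ∈ Icc (-M) M, ∀ φ, IsBumpFunction φ → tsupport φ ⊆ Q →
      0 ≤ ∫ z in Q, fderiv ℝ φ z (fluxJump G κ (v z)) ∂μ)
    {ξ : E → ℝ} (hξ : IsBumpFunction ξ) (hξU : tsupport ξ ⊆ U) :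
    0 ≤ ∫ z in Q, fderiv ℝ ξ z (fluxJump G (u z) (v z)) ∂μ := by
  have hJ := continuous_fluxJump hGc
  have hM0 : -M ≤ M := (haM 0).1.trans (haM 0).2
  have hJB : ∀ a ∈ Icc (-M) M, ∀ b ∈ Icc (-M) M, ‖fluxJump G a b‖ ≤ 2 * C * (2 * M) := by
    intro a ha b hb
    refine (norm_fluxJump_le hG ha hb).trans ?_
    have : |b - a| ≤ 2 * M := by rw [abs_le]; constructor <;> linarith [ha.1, ha.2, hb.1, hb.2]
    gcongr
  have hVm : Measurable fun z => fluxJump G (u z) (v z) := hJ.measurable.comp (hu.prodMk hv)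
  have hVB : ∀ z, ‖fluxJump G (u z) (v z)‖ ≤ 2 * C * (2 * M) := fun z => hJB _ (huM z) _ (hvM z)
  obtain ⟨B, hB⟩ := hξ.contDiff.continuous.bounded_above_of_compact_support hξ.hasCompactSupport
  have hξB : ∀ z, ξ z ≤ B := fun z => (Real.le_norm_self _).trans (hB z)
  have hB0 : 0 ≤ B := (hξ.nonneg 0).trans (hξB 0)
  -- the boundary terms as measures
  have hdens : ∀ k ∈ Icc (-M) M, ∃ ν : Measure E, IsFiniteMeasureOnCompacts ν ∧
      ∀ φ : E → ℝ, ∫ z, φ z ∂ν = ∫ z, φ z * (D * |a z - k|) ∂m := by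
    intro k hk
    have hle : ∀ z, D * |a z - k| ≤ D * (2 * M) := fun z => by
      have : |a z - k| ≤ 2 * M := by
        rw [abs_le]; constructor <;> linarith [(haM z).1, (haM z).2, hk.1, hk.2]
      gcongr
    have hmeas : Measurable fun z => Real.toNNReal (D * |a z - k|) :=
      (((ha.sub_const k).abs).const_mul D).real_toNNReal
    refine ⟨m.withDensity fun z => (Real.toNNReal (D * |a z - k|) : ENNReal), ⟨fun K hK => ?_⟩,
      fun φ => ?_⟩
    · have h1 : m.withDensity (fun z => (Real.toNNReal (D * |a z - k|) : ENNReal)) K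
          ≤ m.withDensity (fun _ => (Real.toNNReal (D * (2 * M)) : ENNReal)) K :=
        withDensity_mono (Eventually.of_forall fun z => by
          have := Real.toNNReal_le_toNNReal (hle z)
          exact_mod_cast this) K
      refine h1.trans_lt ?_
      rw [withDensity_const, Measure.smul_apply]
      exact ENNReal.mul_lt_top ENNReal.coe_lt_top hK.measure_lt_top
    · rw [integral_withDensity_eq_integral_smul hmeas]
      refine integral_congr_ae (Eventually.of_forall fun z => ?_)
      simp only [NNReal.smul_def, smul_eq_mul,
        Real.coe_toNNReal _ (mul_nonneg hD (abs_nonneg (a z - k)))]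
      ring
  -- `B` weights the `L¹` error in approximating `a`, `∫ ξ` the oscillation of the approximation;
  -- the 2 comes from `kato_of_kernel`.
  set c := 2 * D * (B + ∫ z, ξ z ∂m) with hc
  have hc0 : 0 ≤ c := mul_nonneg (by positivity) (add_nonneg hB0 (integral_nonneg hξ.nonneg))
  suffices h : ∀ ε > 0, 0 ≤ ∫ z in Q, fderiv ℝ ξ z (fluxJump G (u z) (v z)) ∂μ + c * ε by
    refine le_of_forall_pos_le_add fun ε hε => ?_
    refine (h (ε / (c + 1)) (by positivity)).trans ?_
    have : c * (ε / (c + 1)) ≤ ε := by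
      rw [mul_div_assoc', div_le_iff₀ (by positivity)]
      nlinarith
    linarith
  intro ε hε
  -- a continuous approximation of the boundary datum
  set K := tsupport ξ with hK_def
  have hK : IsCompact K := hξ.hasCompactSupport.isCompact
  have : IsFiniteMeasure (m.restrict K) := ⟨by
    rw [Measure.restrict_apply_univ]; exact hK.measure_lt_top⟩
  have haK : Integrable a (m.restrict K) :=
    Integrable.of_bound ha.aestronglyMeasurable M
      (Eventually.of_forall fun z => abs_le.2 (haM z))
  obtain ⟨b₀, -, hb₀, hb₀c, hb₀i⟩ := haK.exists_hasCompactSupport_integral_sub_le hε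
  -- Truncation makes the values of `b` admissible levels and does not increase the distance to `a`.
  set b : E → ℝ := fun z => max (-M) (min (b₀ z) M) with hb_def
  have hbc : Continuous b := by fun_prop
  have hbM : ∀ z, b z ∈ Icc (-M) M := fun z =>
    ⟨le_max_left _ _, max_le hM0 (min_le_right _ _)⟩
  have hab : ∀ z, |a z - b z| ≤ |a z - b₀ z| := by
    intro z
    have h1 : a z = max (-M) (min (a z) M) := by
      rw [min_eq_left (haM z).2, max_eq_right (haM z).1]
    calc |a z - b z| = |max (-M) (min (a z) M) - max (-M) (min (b₀ z) M)| := by rw [← h1]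
      _ ≤ |min (a z) M - min (b₀ z) M| := by
          rw [max_comm (-M), max_comm (-M)]; exact abs_max_sub_max_le_abs _ _ _
      _ ≤ |a z - b₀ z| := by
          simpa using abs_min_sub_min_le_max (a z) M (b₀ z) M
  -- a partition subordinate to neighbourhoods with kernels and small oscillation of `b`
  choose! W hWo hWmem hWker using hker
  set W' : K → Set E := fun i => W i ∩ {z | |b z - b i| < ε} with hW'
  have hW'o : ∀ i, IsOpen (W' i) := fun i => (hWo i (hξU i.2)).inter
    (isOpen_lt (by fun_prop) continuous_const)
  obtain ⟨T, η, hη, hηW, hηsum⟩ := hξ.exists_partition hW'o fun z hz =>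
    mem_iUnion.2 ⟨⟨z, hz⟩, hWmem z (hξU hz), by simpa using hε⟩
  -- On each piece the fixed level is `k = b i`, and the boundary error is the measure of density `D
  -- |a - b i|` with respect to `m`.
  have hloc : ∀ i ∈ T, 0 ≤ ∫ z in Q, fderiv ℝ (η i) z (fluxJump G (u z) (v z)) ∂μ
      + 2 * ∫ z, η i z * (D * |a z - b i|) ∂m := by
    intro i _
    obtain ⟨ν, hν, hνint⟩ := hdens (b i) (hbM i)
    rw [← hνint]
    refine kato_of_kernel hQ hU hGc hG hu hv huM hvM (hbM i) (hη i)
      (((hηW i).trans inter_subset_left).trans hξU) (fun r hr => ?_) ?_ ?_ huint hvint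
    · obtain ⟨ρ, h1, h2, h3, h4⟩ := hWker i (hξU i.2) r hr
      exact ⟨ρ, h1, h2, h3, fun z hz => h4 z ⟨((hηW i) hz.1).2.1, hz.2⟩⟩
    · intro κ hκ φ hφ hφU
      rw [hνint]
      exact husub _ (hbM i) κ hκ φ hφ hφU
    · intro κ hκ φ hφ hφU
      rw [hνint]
      exact hvsup _ (hbM i) κ hκ φ hφ hφU
  have hsum := Finset.sum_nonneg hloc
  rw [Finset.sum_add_distrib, ← Finset.mul_sum] at hsum
  have hmain : ∑ i ∈ T, ∫ z in Q, fderiv ℝ (η i) z (fluxJump G (u z) (v z)) ∂μ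
      = ∫ z in Q, fderiv ℝ ξ z (fluxJump G (u z) (v z)) ∂μ := by
    rw [← integral_finsetSum _ fun i _ => (hη i).integrable_fderiv hVm hVB]
    refine integral_congr_ae (Eventually.of_forall fun z => ?_)
    have : ξ = fun z => ∑ i ∈ T, η i z := funext fun z => (hηsum z).symm
    simp only
    rw [this, fderiv_fun_sum fun i _ => (hη i).differentiable z]
    simp
  have hηi : ∀ i, Integrable (η i) m := fun i => (hη i).integrable
  have hosc : ∀ i ∈ T, ∫ z, η i z * (D * |a z - b i|) ∂m
      ≤ ∫ z, (η i z * (D * |a z - b z|) + D * ε * η i z) ∂m := by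
    intro i _
    have hbnd : ∀ z, ‖D * |a z - b z|‖ ≤ D * (2 * M) := fun z => by
      rw [Real.norm_of_nonneg (by positivity)]
      have : |a z - b z| ≤ 2 * M := by
        rw [abs_le]; constructor <;> linarith [(haM z).1, (haM z).2, (hbM z).1, (hbM z).2]
      gcongr
    refine integral_mono_of_nonneg (Eventually.of_forall fun z =>
      mul_nonneg ((hη i).nonneg z) (by positivity)) (Integrable.add ?_ ((hηi i).const_mul _))
      (Eventually.of_forall fun z => ?_)
    · refine (hηi i).mul_bdd ?_ (Eventually.of_forall hbnd)
      exact ((ha.sub hbc.measurable).abs.const_mul D).aestronglyMeasurable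
    · simp only
      by_cases hz : η i z = 0
      · simp [hz]
      · have h1 : |b z - b i| < ε := ((hηW i) (subset_tsupport _ hz)).2.2
        have h2 := abs_sub_le (a z) (b z) (b i)
        have h3 := (hη i).nonneg z
        calc η i z * (D * |a z - b i|) ≤ η i z * (D * (|a z - b z| + ε)) := by
              gcongr; linarith
          _ = _ := by ring
  have hbnd : ∀ z, ‖D * |a z - b z|‖ ≤ D * (2 * M) := fun z => by
    rw [Real.norm_of_nonneg (by positivity)]
    have : |a z - b z| ≤ 2 * M := by
      rw [abs_le]; constructor <;> linarith [(haM z).1, (haM z).2, (hbM z).1, (hbM z).2]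
    gcongr
  have hmab : AEStronglyMeasurable (fun z => D * |a z - b z|) m :=
    ((ha.sub hbc.measurable).abs.const_mul D).aestronglyMeasurable
  have hi1 : ∀ i, Integrable (fun z => η i z * (D * |a z - b z|) + D * ε * η i z) m := fun i =>
    ((hηi i).mul_bdd hmab (Eventually.of_forall hbnd)).add ((hηi i).const_mul _)
  have hξi : Integrable ξ m := hξ.integrable
  have hi2 : Integrable (fun z => ξ z * (D * |a z - b z|)) m :=
    hξi.mul_bdd hmab (Eventually.of_forall hbnd)
  have hbdry : ∑ i ∈ T, ∫ z, η i z * (D * |a z - b i|) ∂m ≤ D * (B + ∫ z, ξ z ∂m) * ε := by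
    calc _ ≤ ∑ i ∈ T, ∫ z, (η i z * (D * |a z - b z|) + D * ε * η i z) ∂m :=
          Finset.sum_le_sum hosc
      _ = ∫ z, (ξ z * (D * |a z - b z|) + D * ε * ξ z) ∂m := by
          rw [← integral_finsetSum _ fun i _ => hi1 i]
          refine integral_congr_ae (Eventually.of_forall fun z => ?_)
          simp only
          rw [Finset.sum_add_distrib, ← Finset.sum_mul, ← Finset.mul_sum, hηsum]
      _ = ∫ z, ξ z * (D * |a z - b z|) ∂m + D * ε * ∫ z, ξ z ∂m := by
          rw [integral_add hi2 (hξi.const_mul _), integral_const_mul]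
      _ ≤ B * D * ε + D * ε * ∫ z, ξ z ∂m := by
          gcongr
          have hzero : ∀ z ∉ K, ξ z * (D * |a z - b z|) = 0 := fun z hz => by
            rw [image_eq_zero_of_notMem_tsupport hz, zero_mul]
          rw [← setIntegral_eq_integral_of_forall_compl_eq_zero hzero]
          calc ∫ z in K, ξ z * (D * |a z - b z|) ∂m ≤ ∫ z in K, B * D * ‖a z - b₀ z‖ ∂m := by
                refine integral_mono_of_nonneg (Eventually.of_forall fun z =>
                  mul_nonneg (hξ.nonneg z) (by positivity)) ?_ (Eventually.of_forall fun z => ?_)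
                · refine Integrable.const_mul (Integrable.norm (haK.sub hb₀i)) _
                · simp only [Real.norm_eq_abs, mul_assoc]
                  exact mul_le_mul (hξB z) (mul_le_mul_of_nonneg_left (hab z) hD)
                    (by positivity) hB0
            _ = B * D * ∫ z in K, ‖a z - b₀ z‖ ∂m := integral_const_mul _ _
            _ ≤ B * D * ε := by gcongr
      _ = _ := by ring
  rw [hmain] at hsum
  rw [hc]
  linarith

end GlobalKato

/-! ### From the entropy inequalities to the abstract setting -/

section Bridge

variable {d : ℕ}

/-- The space-time flux `s ↦ (s, f(s))`. -/
def spaceTimeFlux (f : ℝ → Space d) (s : ℝ) : ℝ × Space d := (s, f s)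

theorem fluxJump_spaceTimeFlux (f : ℝ → Space d) (a b : ℝ) :
    fluxJump (spaceTimeFlux f) a b = (max (a - b) 0, if b < a then f a - f b else 0) := by
  rcases lt_or_ge b a with h | h
  · simp [fluxJump, spaceTimeFlux, h, h.le]
  · simp only [fluxJump_of_le h, not_lt.2 h, if_false, max_eq_right (sub_nonpos.2 h)]
    rfl

theorem mul_timeDeriv_add_inner {ζ : ℝ × Space d → ℝ} {p : ℝ × Space d}
    (hζ : DifferentiableAt ℝ ζ p) (a : ℝ) (F : Space d) :
    a * timeDeriv ζ p + inner ℝ F (spaceGradient ζ p) = fderiv ℝ ζ p (a, F) := by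
  have h1 : timeDeriv ζ p = fderiv ℝ ζ p (1, 0) := by
    have e : HasDerivAt (fun s : ℝ => (s, p.2)) ((1 : ℝ), (0 : Space d)) p.1 :=
      (hasDerivAt_id p.1).prodMk (hasDerivAt_const _ _)
    exact (HasFDerivAt.comp_hasDerivAt p.1 (f := fun s : ℝ => (s, p.2)) hζ.hasFDerivAt e).deriv
  have h2 : inner ℝ F (spaceGradient ζ p) = fderiv ℝ ζ p (0, F) := by
    rw [real_inner_comm, spaceGradient, inner_gradient_eq_fderiv]
    have e : HasFDerivAt (fun y : Space d => (p.1, y)) (ContinuousLinearMap.inr ℝ ℝ (Space d)) p.2 :=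
      (hasFDerivAt_const p.1 p.2).prodMk (hasFDerivAt_id p.2)
    have := HasFDerivAt.comp p.2 (f := fun y : Space d => (p.1, y)) hζ.hasFDerivAt e
    rw [show (fun y => ζ (p.1, y)) = ζ ∘ fun y => (p.1, y) from rfl, this.fderiv]
    simp
  have h3 : ((a, F) : ℝ × Space d) = a • ((1 : ℝ), (0 : Space d)) + ((0 : ℝ), F) := by simp
  rw [h1, h2, h3, map_add, map_smul, smul_eq_mul]

theorem IsBumpFunction.isTestFunction {φ : ℝ × Space d → ℝ} (hφ : IsBumpFunction φ) :
    IsTestFunction φ :=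
  ⟨hφ.contDiff, hφ.hasCompactSupport, fun _ _ _ => hφ.nonneg _⟩

theorem IsEntropySolution.nonneg_plus {f : ℝ → Space d} {Ω : Set (Space d)} {u₀ : Space d → ℝ}
    {ub u : ℝ → Space d → ℝ} (hu : IsEntropySolution f Ω u₀ ub u) (k : ℝ) {φ : ℝ × Space d → ℝ}
    (hφ : IsBumpFunction φ) :
    0 ≤ ∫ p, fderiv ℝ φ p (fluxJump (spaceTimeFlux f) (u p.1 p.2) k) ∂(cylinderMeasure Ω)
      + ∫ p, φ p * omegaPlus f Ω p.2 k (ub p.1 p.2) ∂(lateralMeasure Ω)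
      + ∫ x in Ω, max (u₀ x - k) 0 * φ (0, x) := by
  have := hu.entropy_plus k φ hφ.isTestFunction
  refine this.trans_eq ?_
  congr 2
  refine integral_congr_ae (Eventually.of_forall fun p => ?_)
  simp only
  rw [fluxJump_spaceTimeFlux, ← mul_timeDeriv_add_inner (hφ.differentiable p)]
  split_ifs <;> simp

theorem IsEntropySolution.nonneg_minus {f : ℝ → Space d} {Ω : Set (Space d)} {u₀ : Space d → ℝ}
    {ub u : ℝ → Space d → ℝ} (hu : IsEntropySolution f Ω u₀ ub u) (k : ℝ) {φ : ℝ × Space d → ℝ}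
    (hφ : IsBumpFunction φ) :
    0 ≤ ∫ p, fderiv ℝ φ p (fluxJump (spaceTimeFlux f) k (u p.1 p.2)) ∂(cylinderMeasure Ω)
      + ∫ p, φ p * omegaMinus f Ω p.2 k (ub p.1 p.2) ∂(lateralMeasure Ω)
      + ∫ x in Ω, max (k - u₀ x) 0 * φ (0, x) := by
  have := hu.entropy_minus k φ hφ.isTestFunction
  refine this.trans_eq ?_
  congr 2
  refine integral_congr_ae (Eventually.of_forall fun p => ?_)
  simp only
  rw [fluxJump_spaceTimeFlux, ← mul_timeDeriv_add_inner (hφ.differentiable p)]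
  split_ifs <;> simp

theorem omegaPlus_nonneg (f : ℝ → Space d) (Ω : Set (Space d)) (x : Space d) (k α : ℝ) :
    0 ≤ omegaPlus f Ω x k α := by
  refine Real.sSup_nonneg ?_
  rintro _ ⟨p, -, rfl⟩
  exact abs_nonneg _

theorem omegaMinus_nonneg (f : ℝ → Space d) (Ω : Set (Space d)) (x : Space d) (k α : ℝ) :
    0 ≤ omegaMinus f Ω x k α := by
  refine Real.sSup_nonneg ?_
  rintro _ ⟨p, -, rfl⟩
  exact abs_nonneg _

theorem abs_inner_outerUnitNormal_le {f : ℝ → Space d} {C : NNReal} {S : Set ℝ}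
    (hf : LipschitzOnWith C f S) (Ω : Set (Space d)) (x : Space d) {r s : ℝ} (hr : r ∈ S)
    (hs : s ∈ S) : |inner ℝ (f r - f s) (outerUnitNormal Ω x)| ≤ C * |r - s| := by
  calc |inner ℝ (f r - f s) (outerUnitNormal Ω x)| ≤ ‖f r - f s‖ * ‖outerUnitNormal Ω x‖ :=
        abs_real_inner_le_norm _ _
    _ ≤ ‖f r - f s‖ * 1 := by gcongr; exact norm_outerUnitNormal_le Ω x
    _ ≤ C * |r - s| := by rw [mul_one]; exact hf.norm_sub_le hr hs

/-- The oscillation over `[κ, max α κ]` is at most `C (α - κ)⁺`, and `κ ≥ k`. The bound does not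
depend on `κ`, as needed in the doubling, where the level varies with the other solution. -/
theorem omegaPlus_le {f : ℝ → Space d} {C : NNReal} {M : ℝ} (hf : LipschitzOnWith C f (Icc (-M) M))
    (Ω : Set (Space d)) (x : Space d) {k κ α : ℝ} (hk : k ∈ Icc (-M) M) (hκ : κ ∈ Icc k M)
    (hα : α ∈ Icc (-M) M) : omegaPlus f Ω x κ α ≤ C * |α - k| := by
  refine Real.sSup_le ?_ (by positivity)
  rintro _ ⟨⟨r, s⟩, ⟨hr, hs⟩, rfl⟩
  have hmax : max α κ ≤ M := max_le hα.2 hκ.2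
  refine (abs_inner_outerUnitNormal_le hf Ω x ⟨hk.1.trans (hκ.1.trans hr.1), hr.2.trans hmax⟩
    ⟨hk.1.trans (hκ.1.trans hs.1), hs.2.trans hmax⟩).trans ?_
  refine mul_le_mul_of_nonneg_left ?_ C.coe_nonneg
  have h1 : |r - s| ≤ max α κ - κ := by
    simp only [mem_Icc] at hr hs
    rw [abs_le]
    constructor <;> linarith [hr.1, hr.2, hs.1, hs.2]
  refine h1.trans ?_
  rcases le_total α κ with h | h
  · simp [h]
  · rw [max_eq_left h]
    exact (sub_le_sub_left hκ.1 α).trans (le_abs_self _)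

theorem omegaMinus_le {f : ℝ → Space d} {C : NNReal} {M : ℝ}
    (hf : LipschitzOnWith C f (Icc (-M) M)) (Ω : Set (Space d)) (x : Space d) {k κ α : ℝ}
    (hk : k ∈ Icc (-M) M) (hκ : κ ∈ Icc (-M) k) (hα : α ∈ Icc (-M) M) :
    omegaMinus f Ω x κ α ≤ C * |α - k| := by
  refine Real.sSup_le ?_ (by positivity)
  rintro _ ⟨⟨r, s⟩, ⟨hr, hs⟩, rfl⟩
  have hmin : -M ≤ min α κ := le_min hα.1 hκ.1
  refine (abs_inner_outerUnitNormal_le hf Ω x ⟨hmin.trans hr.1, hr.2.trans (hκ.2.trans hk.2)⟩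
    ⟨hmin.trans hs.1, hs.2.trans (hκ.2.trans hk.2)⟩).trans ?_
  refine mul_le_mul_of_nonneg_left ?_ C.coe_nonneg
  have h1 : |r - s| ≤ κ - min α κ := by
    simp only [mem_Icc] at hr hs
    rw [abs_le]
    constructor <;> linarith [hr.1, hr.2, hs.1, hs.2]
  refine h1.trans ?_
  rcases le_total κ α with h | h
  · simp [h]
  · rw [min_eq_left h, abs_sub_comm]
    exact (sub_le_sub_right hκ.2 α).trans (le_abs_self _)

theorem omegaPlus_eq_zero (f : ℝ → Space d) (Ω : Set (Space d)) (x : Space d) {k α : ℝ}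
    (h : α ≤ k) : omegaPlus f Ω x k α = 0 := by
  simp [omegaPlus, max_eq_right h]

theorem omegaMinus_eq_zero (f : ℝ → Space d) (Ω : Set (Space d)) (x : Space d) {k α : ℝ}
    (h : k ≤ α) : omegaMinus f Ω x k α = 0 := by
  simp [omegaMinus, min_eq_right h]

instance isAddHaarMeasure_volume_prod :
    (volume : Measure (ℝ × Space d)).IsAddHaarMeasure := by
  rw [Measure.volume_eq_prod]
  infer_instance

/-- Essentially bounded functions have bounded measurable representatives. -/
theorem exists_measurable_representative {α : Type*} [MeasurableSpace α] {ν : Measure α} {g : α → ℝ}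
    (hg : MemLp g ⊤ ν) : ∃ M₀ : ℝ, ∀ M, M₀ ≤ M → ∃ g' : α → ℝ, Measurable g' ∧
      (∀ z, g' z ∈ Icc (-M) M) ∧ g =ᵐ[ν] g' := by
  refine ⟨(eLpNormEssSup g ν).toReal, fun M hM => ?_⟩
  have hM0 : 0 ≤ M := ENNReal.toReal_nonneg.trans hM
  have hfin : eLpNormEssSup g ν ≠ ⊤ := by
    have := hg.2
    rw [eLpNorm_exponent_top] at this
    exact this.ne
  obtain ⟨g₁, hg₁, hgg₁⟩ := hg.1
  refine ⟨fun z => max (-M) (min (g₁ z) M),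
    measurable_const.max (hg₁.measurable.min measurable_const), fun z =>
    ⟨le_max_left _ _, max_le (by linarith) (min_le_right _ _)⟩, ?_⟩
  filter_upwards [hgg₁, ae_le_eLpNormEssSup (f := g) (μ := ν)] with z hz1 hz2
  have h1 : |g z| ≤ M := by
    have := ENNReal.toReal_mono hfin hz2
    rw [toReal_enorm, Real.norm_eq_abs] at this
    exact this.trans hM
  rw [← hz1, min_eq_left (abs_le.1 h1).2, max_eq_right (abs_le.1 h1).1]

theorem exists_lipschitzOnWith_spaceTimeFlux {f : ℝ → Space d} (hf : ContDiff ℝ 1 f) (M : ℝ) :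
    ∃ C : NNReal, LipschitzOnWith C f (Icc (-M) M) ∧
      LipschitzOnWith C (spaceTimeFlux f) (Icc (-M) M) := by
  obtain ⟨B, hB⟩ := (isCompact_Icc (a := -M) (b := M)).exists_bound_of_continuousOn
    (hf.continuous_deriv le_rfl).continuousOn
  have h1 : LipschitzOnWith B.toNNReal f (Icc (-M) M) := by
    refine (convex_Icc (-M) M).lipschitzOnWith_of_nnnorm_deriv_le
      (fun x _ => hf.differentiable (by simp) x) fun x hx => ?_
    rw [← NNReal.coe_le_coe, coe_nnnorm]
    exact (hB x hx).trans (Real.le_coe_toNNReal B)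
  refine ⟨max 1 B.toNNReal, h1.weaken (le_max_right _ _), ?_⟩
  exact (LipschitzWith.id.lipschitzOnWith).prodMk h1

theorem continuous_spaceTimeFlux {f : ℝ → Space d} (hf : Continuous f) :
    Continuous (spaceTimeFlux f) := continuous_id.prodMk hf

theorem ae_lateral_mem_frontier (Ω : Set (Space d)) [SFinite (surfaceMeasure Ω)] :
    ∀ᵐ p ∂(lateralMeasure Ω), p.2 ∈ frontier Ω := by
  have h : ∀ᵐ x ∂(surfaceMeasure Ω), x ∈ frontier Ω :=
    ae_restrict_mem isClosed_frontier.measurableSet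
  exact Measure.quasiMeasurePreserving_snd.ae h

theorem sFinite_surfaceMeasure (hd : 1 ≤ d) {Ω : Set (Space d)} (hΩ : IsC2Domain Ω) :
    SFinite (surfaceMeasure Ω) := by
  have := isFiniteMeasureOnCompacts_surfaceMeasure hd hΩ
  infer_instance

theorem isFiniteMeasureOnCompacts_lateralMeasure (hd : 1 ≤ d) {Ω : Set (Space d)}
    (hΩ : IsC2Domain Ω) : IsFiniteMeasureOnCompacts (lateralMeasure Ω) := by
  have := isFiniteMeasureOnCompacts_surfaceMeasure hd hΩ
  have := sFinite_surfaceMeasure hd hΩ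
  unfold lateralMeasure
  infer_instance

/-- Kato's inequality for two entropy solutions with the same boundary datum, for test functions
vanishing near the initial time. -/
theorem IsEntropySolution.kato (hd : 1 ≤ d) {f : ℝ → Space d} (hf : ContDiff ℝ 1 f)
    {Ω : Set (Space d)} (hΩ : IsC2Domain Ω) {u₀ v₀ : Space d → ℝ} {ub : ℝ → Space d → ℝ}
    (hub : MemLp (fun p : ℝ × Space d => ub p.1 p.2) ⊤ (lateralMeasure Ω))
    {u v : ℝ → Space d → ℝ} (hu : IsEntropySolution f Ω u₀ ub u)
    (hv : IsEntropySolution f Ω v₀ ub v) {ξ : ℝ × Space d → ℝ} (hξ : IsBumpFunction ξ)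
    (hξ0 : tsupport ξ ⊆ {p | 0 < p.1}) :
    0 ≤ ∫ p, fderiv ℝ ξ p (fluxJump (spaceTimeFlux f) (u p.1 p.2) (v p.1 p.2))
      ∂(cylinderMeasure Ω) := by
  have := isFiniteMeasureOnCompacts_surfaceMeasure hd hΩ
  have := sFinite_surfaceMeasure hd hΩ
  have := isFiniteMeasureOnCompacts_lateralMeasure hd hΩ
  obtain ⟨M₁, hM₁⟩ := exists_measurable_representative hu.memLp
  obtain ⟨M₂, hM₂⟩ := exists_measurable_representative hv.memLp
  obtain ⟨M₃, hM₃⟩ := exists_measurable_representative hub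
  set M := max M₁ (max M₂ M₃)
  obtain ⟨u', hu'm, hu'M, huu'⟩ := hM₁ M (le_max_left _ _)
  obtain ⟨v', hv'm, hv'M, hvv'⟩ := hM₂ M ((le_max_left _ _).trans (le_max_right _ _))
  obtain ⟨a, ham, haM, hua⟩ := hM₃ M ((le_max_right _ _).trans (le_max_right _ _))
  obtain ⟨C, hCf, hCG⟩ := exists_lipschitzOnWith_spaceTimeFlux hf M
  have hGc := continuous_spaceTimeFlux hf.continuous
  set Q : Set (ℝ × Space d) := Ioi 0 ×ˢ Ω with hQ_def
  have hQ : IsOpen Q := isOpen_Ioi.prod hΩ.1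
  set U : Set (ℝ × Space d) := {p | 0 < p.1} with hU_def
  have hU : IsOpen U := isOpen_lt continuous_const continuous_fst
  have hinit : ∀ (g : Space d → ℝ) (φ : ℝ × Space d → ℝ), tsupport φ ⊆ U →
      ∫ x in Ω, g x * φ (0, x) = 0 := by
    intro g φ hφU
    refine integral_eq_zero_of_ae (Eventually.of_forall fun x => ?_)
    have : φ (0, x) = 0 := by
      by_contra hne
      exact lt_irrefl (0 : ℝ) (hφU (subset_tsupport _ hne))
    simp [this]
  have hlat : ∀ (g : ℝ × Space d → ℝ) (φ : ℝ × Space d → ℝ), tsupport φ ⊆ Q →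
      ∫ p, φ p * g p ∂(lateralMeasure Ω) = 0 := by
    intro g φ hφQ
    refine integral_eq_zero_of_ae ?_
    filter_upwards [ae_lateral_mem_frontier Ω] with p hp
    have : φ p = 0 := by
      by_contra hne
      have h1 := (hφQ (subset_tsupport _ hne)).2
      rw [hΩ.1.frontier_eq] at hp
      exact hp.2 h1
    simp [this]
  have hcylp : ∀ (κ : ℝ) (φ : ℝ × Space d → ℝ),
      ∫ p, fderiv ℝ φ p (fluxJump (spaceTimeFlux f) (u p.1 p.2) κ) ∂(cylinderMeasure Ω)
      = ∫ z in Q, fderiv ℝ φ z (fluxJump (spaceTimeFlux f) (u' z) κ) := by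
    intro κ φ
    refine integral_congr_ae ?_
    filter_upwards [huu'] with p hp
    rw [hp]
  have hcylm : ∀ (κ : ℝ) (φ : ℝ × Space d → ℝ),
      ∫ p, fderiv ℝ φ p (fluxJump (spaceTimeFlux f) κ (v p.1 p.2)) ∂(cylinderMeasure Ω)
      = ∫ z in Q, fderiv ℝ φ z (fluxJump (spaceTimeFlux f) κ (v' z)) := by
    intro κ φ
    refine integral_congr_ae ?_
    filter_upwards [hvv'] with p hp
    rw [hp]
  have hbdint : ∀ k ∈ Icc (-M) M, ∀ φ : ℝ × Space d → ℝ, IsBumpFunction φ →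
      Integrable (fun p => φ p * ((C : ℝ) * |a p - k|)) (lateralMeasure Ω) := by
    intro k hk φ hφ
    refine hφ.integrable.mul_bdd (c := C * (2 * M))
      (((ham.sub_const k).abs).const_mul _).aestronglyMeasurable (Eventually.of_forall fun p => ?_)
    rw [Real.norm_of_nonneg (by positivity)]
    have : |a p - k| ≤ 2 * M := by
      rw [abs_le]; constructor <;> linarith [(haM p).1, (haM p).2, hk.1, hk.2]
    gcongr
  have key := kato_inequality (μ := volume) hQ hU hGc hCG hu'm hv'm hu'M hv'M
    (m := lateralMeasure Ω) ham haM C.coe_nonneg (fun z₀ hz₀ => hΩ.exists_kernel hz₀)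
    ?_ ?_ ?_ ?_ hξ hξ0
  · refine key.trans_eq (integral_congr_ae ?_)
    filter_upwards [huu', hvv'] with p hp1 hp2
    rw [hp1, hp2]
  · intro k hk κ hκ φ hφ hφU
    have h1 := hu.nonneg_plus κ hφ
    rw [hinit (fun x => max (u₀ x - κ) 0) φ hφU, add_zero, hcylp] at h1
    refine h1.trans (add_le_add le_rfl ?_)
    refine integral_mono_of_nonneg (Eventually.of_forall fun p =>
      mul_nonneg (hφ.nonneg p) (omegaPlus_nonneg _ _ _ _ _)) (hbdint k hk φ hφ) ?_
    filter_upwards [hua] with p hp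
    rw [hp]
    exact mul_le_mul_of_nonneg_left (omegaPlus_le hCf Ω p.2 hk hκ (haM p)) (hφ.nonneg p)
  · intro k hk κ hκ φ hφ hφU
    have h1 := hv.nonneg_minus κ hφ
    rw [hinit (fun x => max (κ - v₀ x) 0) φ hφU, add_zero, hcylm] at h1
    refine h1.trans (add_le_add le_rfl ?_)
    refine integral_mono_of_nonneg (Eventually.of_forall fun p =>
      mul_nonneg (hφ.nonneg p) (omegaMinus_nonneg _ _ _ _ _)) (hbdint k hk φ hφ) ?_
    filter_upwards [hua] with p hp
    rw [hp]
    exact mul_le_mul_of_nonneg_left (omegaMinus_le hCf Ω p.2 hk hκ (haM p)) (hφ.nonneg p)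
  · intro κ hκ φ hφ hφQ
    have h1 := hu.nonneg_plus κ hφ
    rwa [hinit (fun x => max (u₀ x - κ) 0) φ (hφQ.trans fun p hp => hp.1), add_zero, hcylp,
      hlat (fun p => omegaPlus f Ω p.2 κ (ub p.1 p.2)) φ hφQ, add_zero] at h1
  · intro κ hκ φ hφ hφQ
    have h1 := hv.nonneg_minus κ hφ
    rwa [hinit (fun x => max (κ - v₀ x) 0) φ (hφQ.trans fun p hp => hp.1), add_zero, hcylm,
      hlat (fun p => omegaMinus f Ω p.2 κ (ub p.1 p.2)) φ hφQ, add_zero] at h1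

end Bridge

/-! ### Finite speed of propagation and the maximum principle -/

section FiniteSpeed

variable {d : ℕ}

/-- A smooth weight decreasing in time and supported in a backward cone of slope `C`. -/
noncomputable def coneWeight (C R : ℝ) (p : ℝ × Space d) : ℝ :=
  Real.smoothTransition (p.1 + 2) * (Real.exp (-p.1)
    * expNegInvGlue (R - √(1 + ‖p.2‖ ^ 2) - C * p.1))

theorem contDiff_coneWeight (C R : ℝ) : ContDiff ℝ ∞ (coneWeight (d := d) C R) := by
  have h1 : ContDiff ℝ ∞ fun p : ℝ × Space d => √(1 + ‖p.2‖ ^ 2) :=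
    (contDiff_const.add (contDiff_snd.norm_sq ℝ)).sqrt fun p => by positivity
  have h2 : ContDiff ℝ ∞ fun p : ℝ × Space d => R - √(1 + ‖p.2‖ ^ 2) - C * p.1 :=
    (contDiff_const.sub h1).sub (contDiff_const.mul contDiff_fst)
  have h3 : ContDiff ℝ ∞ fun p : ℝ × Space d => Real.smoothTransition (p.1 + 2) :=
    (Real.smoothTransition.contDiff (n := ⊤)).comp (contDiff_fst.add contDiff_const)
  have h4 : ContDiff ℝ ∞ fun p : ℝ × Space d =>
      expNegInvGlue (R - √(1 + ‖p.2‖ ^ 2) - C * p.1) :=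
    (expNegInvGlue.contDiff (n := ⊤)).comp h2
  exact h3.mul (contDiff_fst.neg.exp.mul h4)

theorem isBumpFunction_coneWeight {C : ℝ} (hC : 0 < C) (R : ℝ) :
    IsBumpFunction (coneWeight (d := d) C R) where
  contDiff := contDiff_coneWeight C R
  hasCompactSupport := by
    refine HasCompactSupport.intro ((isCompact_Icc (a := (-2 : ℝ)) (b := R / C)).prod
      (isCompact_closedBall (0 : Space d) (R + 2 * C))) fun p hp => ?_
    by_contra hne
    have h1 := left_ne_zero_of_mul hne
    have h2 := right_ne_zero_of_mul (right_ne_zero_of_mul hne)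
    rw [Ne, Real.smoothTransition.zero_iff_nonpos, not_le] at h1
    rw [Ne, expNegInvGlue.zero_iff_nonpos, not_le] at h2
    have h3 : ‖p.2‖ ≤ √(1 + ‖p.2‖ ^ 2) := Real.le_sqrt_of_sq_le (by linarith)
    have h4 := norm_nonneg p.2
    refine hp ⟨⟨by linarith, ?_⟩, ?_⟩
    · rw [le_div_iff₀ hC]
      nlinarith
    · rw [mem_closedBall_zero_iff]
      nlinarith
  nonneg p := mul_nonneg (Real.smoothTransition.nonneg _)
    (mul_nonneg (Real.exp_pos _).le (expNegInvGlue.nonneg _))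

theorem coneWeight_pos {C R : ℝ} {p : ℝ × Space d} (hp : 0 < p.1)
    (h : √(1 + ‖p.2‖ ^ 2) + C * p.1 < R) : 0 < coneWeight C R p :=
  mul_pos (Real.smoothTransition.pos_of_pos (by linarith))
    (mul_pos (Real.exp_pos _) (expNegInvGlue.pos_of_pos (by linarith)))

theorem fderiv_apply_of_hasDerivAt_line {E : Type*} [NormedAddCommGroup E] [NormedSpace ℝ E]
    {φ : E → ℝ} {p V : E} (hφ : DifferentiableAt ℝ φ p) {D : ℝ}
    (h : HasDerivAt (fun s : ℝ => φ (p + s • V)) D 0) : fderiv ℝ φ p V = D := by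
  rw [← hφ.lineDeriv_eq_fderiv]
  exact h.deriv

theorem deriv_expNegInvGlue_nonneg (x : ℝ) : 0 ≤ deriv expNegInvGlue x :=
  expNegInvGlue.monotone.deriv_nonneg

theorem hasDerivAt_expNegInvGlue (x : ℝ) :
    HasDerivAt expNegInvGlue (deriv expNegInvGlue x) x :=
  ((expNegInvGlue.contDiff (n := 1)).differentiable (by simp) x).hasDerivAt

/-- The factor `exp (-t)` alone produces the right-hand side. The cone factor contributes a
nonpositive term, because the gradient of `√(1 + |x|²)` has norm at most 1 and `‖V.2‖ ≤ C V.1`. The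
transition factor equals 1 for `t ≥ -1` and only cuts off negative times. -/
theorem fderiv_coneWeight_le {C : ℝ} (R : ℝ) {p V : ℝ × Space d} (hp : 0 < p.1)
    (hV : ‖V.2‖ ≤ C * V.1) :
    fderiv ℝ (coneWeight C R) p V ≤ -(V.1 * coneWeight C R p) := by
  have hpos : (0 : ℝ) < 1 + ‖p.2‖ ^ 2 := by positivity
  set q := R - √(1 + ‖p.2‖ ^ 2) - C * p.1 with hq
  have htime : HasDerivAt (fun s : ℝ => p.1 + s * V.1) V.1 0 := by
    simpa using ((hasDerivAt_id (0 : ℝ)).mul_const V.1).const_add p.1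
  have hspace : HasDerivAt (fun s : ℝ => p.2 + s • V.2) V.2 0 := by
    simpa using ((hasDerivAt_id (0 : ℝ)).smul_const V.2).const_add p.2
  have hsqrt : HasDerivAt (fun s : ℝ => √(1 + ‖p.2 + s • V.2‖ ^ 2))
      (inner ℝ p.2 V.2 / √(1 + ‖p.2‖ ^ 2)) 0 := by
    have h1 := (hspace.norm_sq.const_add 1).sqrt (by positivity)
    refine h1.congr_deriv ?_
    simp only [zero_smul, add_zero]
    exact mul_div_mul_left _ _ two_ne_zero
  have hglue : HasDerivAt
      (fun s : ℝ => expNegInvGlue (R - √(1 + ‖p.2 + s • V.2‖ ^ 2) - C * (p.1 + s * V.1)))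
      (deriv expNegInvGlue q * (-(inner ℝ p.2 V.2 / √(1 + ‖p.2‖ ^ 2)) - C * V.1)) 0 := by
    have h1 := (hsqrt.const_sub R).sub (htime.const_mul C)
    refine HasDerivAt.comp (0 : ℝ) (h₂ := expNegInvGlue) ?_ h1
    simpa [hq] using hasDerivAt_expNegInvGlue q
  have hexp : HasDerivAt (fun s : ℝ => Real.exp (-(p.1 + s * V.1)))
      (Real.exp (-p.1) * -V.1) 0 := by
    simpa using htime.neg.exp
  have hone : ∀ t : ℝ, -1 ≤ t → Real.smoothTransition (t + 2) = 1 := fun t ht =>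
    Real.smoothTransition.one_of_one_le (by linarith)
  have hline : HasDerivAt (fun s : ℝ => coneWeight C R (p + s • V))
      (Real.exp (-p.1) * -V.1 * expNegInvGlue q + Real.exp (-p.1)
        * (deriv expNegInvGlue q * (-(inner ℝ p.2 V.2 / √(1 + ‖p.2‖ ^ 2)) - C * V.1))) 0 := by
    have h1 := hexp.fun_mul hglue
    simp only [zero_mul, zero_smul, add_zero, ← hq] at h1
    refine h1.congr_of_eventuallyEq ?_
    have h2 : ∀ᶠ s in 𝓝 (0 : ℝ), 0 < p.1 + s * V.1 :=
      htime.continuousAt.eventually (lt_mem_nhds (by simpa using hp))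
    filter_upwards [h2] with s hs
    simp only [coneWeight, Prod.fst_add, Prod.snd_add, Prod.smul_fst, Prod.smul_snd, smul_eq_mul]
    rw [hone _ (by linarith), one_mul]
  rw [fderiv_apply_of_hasDerivAt_line
    ((contDiff_coneWeight C R).differentiable (by simp) p) hline]
  have hin : -(inner ℝ p.2 V.2 / √(1 + ‖p.2‖ ^ 2)) ≤ C * V.1 := by
    refine le_trans ?_ hV
    rw [← neg_div, div_le_iff₀ (Real.sqrt_pos.2 hpos)]
    have h1 : ‖p.2‖ ≤ √(1 + ‖p.2‖ ^ 2) := Real.le_sqrt_of_sq_le (by linarith)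
    calc -inner ℝ p.2 V.2 ≤ |inner ℝ p.2 V.2| := neg_le_abs _
      _ ≤ ‖p.2‖ * ‖V.2‖ := abs_real_inner_le_norm _ _
      _ ≤ √(1 + ‖p.2‖ ^ 2) * ‖V.2‖ := by gcongr
      _ = ‖V.2‖ * √(1 + ‖p.2‖ ^ 2) := mul_comm _ _
  have hfin : Real.exp (-p.1) * (deriv expNegInvGlue q
      * (-(inner ℝ p.2 V.2 / √(1 + ‖p.2‖ ^ 2)) - C * V.1)) ≤ 0 :=
    mul_nonpos_of_nonneg_of_nonpos (Real.exp_pos _).le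
      (mul_nonpos_of_nonneg_of_nonpos (deriv_expNegInvGlue_nonneg q) (by linarith))
  simp only [coneWeight]
  rw [hone _ (by linarith), one_mul, ← hq]
  linarith

/-- Finite speed of propagation: a field `V = (σ, F)` with `|F| ≤ C σ` which satisfies the weak
inequality `∂_t σ + div F ≤ 0` tested against `φ g`, with a weight `g` decreasing along `V`, has
density zero where `g` does not vanish. -/
theorem ae_eq_zero_of_weak_inequality {Ω : Set (Space d)} (hΩ : IsOpen Ω)
    {V : ℝ × Space d → ℝ × Space d} (hV : Measurable V) {B : ℝ} (hVB : ∀ z, ‖V z‖ ≤ B) {C : ℝ}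
    (hC : 0 < C) (hspeed : ∀ z, ‖(V z).2‖ ≤ C * (V z).1) {g : ℝ × Space d → ℝ}
    (hg : ContDiff ℝ ∞ g) (hg0 : ∀ z, 0 ≤ g z)
    (hgV : ∀ᵐ z ∂(cylinderMeasure Ω), fderiv ℝ g z (V z) ≤ 0)
    (hweak : ∀ φ : ℝ × Space d → ℝ, IsBumpFunction φ →
      0 ≤ ∫ z, fderiv ℝ (fun z => φ z * g z) z (V z) ∂(cylinderMeasure Ω)) :
    ∀ᵐ z ∂(cylinderMeasure Ω), g z = 0 ∨ (V z).1 = 0 := by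
  have hQ : MeasurableSet (Ioi (0 : ℝ) ×ˢ Ω) := measurableSet_Ioi.prod hΩ.measurableSet
  have hfin : IsFiniteMeasureOnCompacts (cylinderMeasure Ω) := by
    unfold cylinderMeasure; infer_instance
  have hσ : ∀ z, 0 ≤ (V z).1 := fun z =>
    nonneg_of_mul_nonneg_right ((norm_nonneg _).trans (hspeed z)) hC
  have hpos : ∀ᵐ z ∂(cylinderMeasure Ω), 0 < z.1 := by
    filter_upwards [ae_restrict_mem hQ] with z hz using hz.1
  have hR : ∀ R : ℕ, ∀ᵐ z ∂(cylinderMeasure Ω), (V z).1 * coneWeight C R z * g z = 0 := by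
    intro R
    set φ : ℝ × Space d → ℝ := coneWeight C R with hφ_def
    have hφ : IsBumpFunction φ := isBumpFunction_coneWeight hC R
    have hφg : IsBumpFunction fun z => φ z * g z := hφ.mul hg hg0
    have hle : ∀ᵐ z ∂(cylinderMeasure Ω),
        fderiv ℝ (fun z => φ z * g z) z (V z) ≤ -((V z).1 * φ z * g z) := by
      filter_upwards [hgV, hpos] with z h1 h2
      have hd := (hφ.differentiable z).hasFDerivAt.fun_mul
        (hg.differentiable (by simp) z).hasFDerivAt
      rw [hd.fderiv]
      have h3 := fderiv_coneWeight_le R h2 (hspeed z)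
      have h4 : φ z * fderiv ℝ g z (V z) ≤ 0 := mul_nonpos_of_nonneg_of_nonpos (hφ.nonneg z) h1
      have h5 : g z * fderiv ℝ φ z (V z) ≤ g z * -((V z).1 * φ z) :=
        mul_le_mul_of_nonneg_left h3 (hg0 z)
      simp only [add_apply, smul_apply, smul_eq_mul]
      linarith
    have hnn : ∀ z, 0 ≤ (V z).1 * φ z * g z := fun z =>
      mul_nonneg (mul_nonneg (hσ z) (hφ.nonneg z)) (hg0 z)
    have hint : Integrable (fun z => fderiv ℝ (fun z => φ z * g z) z (V z)) (cylinderMeasure Ω) :=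
      hφg.integrable_fderiv hV hVB
    -- The differential is nonpositive almost everywhere by `hle`, yet its integral is nonnegative
    -- by `hweak`; so it vanishes almost everywhere.
    have h0 : ∫ z, -fderiv ℝ (fun z => φ z * g z) z (V z) ∂(cylinderMeasure Ω) = 0 := by
      refine le_antisymm ?_ (integral_nonneg_of_ae ?_)
      · rw [integral_neg]
        linarith [hweak φ hφ]
      · filter_upwards [hle] with z hz
        have := hnn z
        simp only [Pi.zero_apply]
        linarith
    have hint' : Integrable (fun z => -fderiv ℝ (fun z => φ z * g z) z (V z))
        (cylinderMeasure Ω) := hint.neg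
    rw [integral_eq_zero_iff_of_nonneg_ae ?_ hint'] at h0
    · filter_upwards [h0, hle] with z h1 h2
      simp only [Pi.zero_apply, neg_eq_zero] at h1
      exact le_antisymm (by linarith) (hnn z)
    · filter_upwards [hle] with z hz
      have := hnn z
      simp only [Pi.zero_apply]
      linarith
  filter_upwards [ae_all_iff.2 hR, hpos] with z hz hz1
  -- The cones with integer `R` exhaust the positive times.
  obtain ⟨R, hR⟩ := exists_nat_gt (√(1 + ‖z.2‖ ^ 2) + C * z.1)
  have h1 := hz R
  have h2 := (coneWeight_pos hz1 hR).ne'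
  rcases mul_eq_zero.1 h1 with h | h
  · exact Or.inr ((mul_eq_zero.1 h).resolve_right h2)
  · exact Or.inl h

/-- The slope is `C + 1` rather than `C` because the cone argument needs a positive speed. -/
theorem norm_fluxJump_snd_le {f : ℝ → Space d} {C : NNReal} {S : Set ℝ}
    (hf : LipschitzOnWith C f S) {a b : ℝ} (ha : a ∈ S) (hb : b ∈ S) :
    ‖(fluxJump (spaceTimeFlux f) a b).2‖ ≤ (C + 1) * (fluxJump (spaceTimeFlux f) a b).1 := by
  rw [fluxJump_spaceTimeFlux]
  rcases lt_or_ge b a with h | h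
  · simp only [h, if_true, max_eq_left (sub_nonneg.2 h.le)]
    have h1 := hf.norm_sub_le ha hb
    rw [Real.norm_of_nonneg (sub_nonneg.2 h.le)] at h1
    linarith
  · simp [not_lt.2 h, max_eq_right (sub_nonpos.2 h)]

/-- Maximum principle: an upper bound on the data is an upper bound on the solution. -/
theorem IsEntropySolution.ae_le {f : ℝ → Space d} (hf : ContDiff ℝ 1 f) {Ω : Set (Space d)}
    (hΩ : IsOpen Ω) {u₀ : Space d → ℝ} {ub u : ℝ → Space d → ℝ}
    (hu : IsEntropySolution f Ω u₀ ub u) {b : ℝ}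
    (hu₀ : ∀ᵐ x ∂(volume.restrict Ω), u₀ x ≤ b)
    (hub : ∀ᵐ p ∂(lateralMeasure Ω), ub p.1 p.2 ≤ b) :
    ∀ᵐ p ∂(cylinderMeasure Ω), u p.1 p.2 ≤ b := by
  obtain ⟨M₁, hM₁⟩ := exists_measurable_representative hu.memLp
  set M := max M₁ |b|
  obtain ⟨u', hu'm, hu'M, huu'⟩ := hM₁ M (le_max_left _ _)
  have hb : b ∈ Icc (-M) M := abs_le.1 (le_max_right M₁ |b|)
  obtain ⟨C, hCf, hCG⟩ := exists_lipschitzOnWith_spaceTimeFlux hf M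
  have hJ := continuous_fluxJump (continuous_spaceTimeFlux hf.continuous)
  have key := ae_eq_zero_of_weak_inequality hΩ
    (V := fun z => fluxJump (spaceTimeFlux f) (u' z) b) (hJ.measurable.comp
      (hu'm.prodMk measurable_const)) (B := 2 * C * (2 * M)) (fun z => by
        refine (norm_fluxJump_le hCG (hu'M z) hb).trans ?_
        have : |b - u' z| ≤ 2 * M := by
          rw [abs_le]; constructor <;> linarith [(hu'M z).1, (hu'M z).2, hb.1, hb.2]
        gcongr)
    (C := C + 1) (by positivity) (fun z => norm_fluxJump_snd_le hCf (hu'M z) hb)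
    (g := fun _ => 1) contDiff_const (fun _ => zero_le_one) (by simp) ?_
  · filter_upwards [key, huu'] with p h1 h2
    rw [h2]
    have h3 := h1.resolve_left one_ne_zero
    rw [fluxJump_spaceTimeFlux] at h3
    have h4 := le_max_left (u' p - b) 0
    simp only at h3
    linarith
  · intro φ hφ
    simp only [mul_one]
    -- At level `b` both the boundary term and the initial term vanish, so the weight `g = 1` is
    -- allowed, even at `t = 0`.
    have h1 := hu.nonneg_plus b hφ
    have h2 : ∫ p, φ p * omegaPlus f Ω p.2 b (ub p.1 p.2) ∂(lateralMeasure Ω) = 0 := by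
      refine integral_eq_zero_of_ae ?_
      filter_upwards [hub] with p hp
      simp [omegaPlus_eq_zero f Ω p.2 hp]
    have h3 : ∫ x in Ω, max (u₀ x - b) 0 * φ (0, x) = 0 := by
      refine integral_eq_zero_of_ae ?_
      filter_upwards [hu₀] with x hx
      simp [hx]
    rw [h2, h3, add_zero, add_zero] at h1
    refine h1.trans_eq (integral_congr_ae ?_)
    filter_upwards [huu'] with p hp
    rw [hp]

/-- Minimum principle: a lower bound on the data is a lower bound on the solution. -/
theorem IsEntropySolution.ae_ge {f : ℝ → Space d} (hf : ContDiff ℝ 1 f) {Ω : Set (Space d)}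
    (hΩ : IsOpen Ω) {u₀ : Space d → ℝ} {ub u : ℝ → Space d → ℝ}
    (hu : IsEntropySolution f Ω u₀ ub u) {b : ℝ}
    (hu₀ : ∀ᵐ x ∂(volume.restrict Ω), b ≤ u₀ x)
    (hub : ∀ᵐ p ∂(lateralMeasure Ω), b ≤ ub p.1 p.2) :
    ∀ᵐ p ∂(cylinderMeasure Ω), b ≤ u p.1 p.2 := by
  obtain ⟨M₁, hM₁⟩ := exists_measurable_representative hu.memLp
  set M := max M₁ |b|
  obtain ⟨u', hu'm, hu'M, huu'⟩ := hM₁ M (le_max_left _ _)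
  have hb : b ∈ Icc (-M) M := abs_le.1 (le_max_right M₁ |b|)
  obtain ⟨C, hCf, hCG⟩ := exists_lipschitzOnWith_spaceTimeFlux hf M
  have hJ := continuous_fluxJump (continuous_spaceTimeFlux hf.continuous)
  have key := ae_eq_zero_of_weak_inequality hΩ
    (V := fun z => fluxJump (spaceTimeFlux f) b (u' z)) (hJ.measurable.comp
      (measurable_const.prodMk hu'm)) (B := 2 * C * (2 * M)) (fun z => by
        refine (norm_fluxJump_le hCG hb (hu'M z)).trans ?_
        have : |u' z - b| ≤ 2 * M := by
          rw [abs_le]; constructor <;> linarith [(hu'M z).1, (hu'M z).2, hb.1, hb.2]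
        gcongr)
    (C := C + 1) (by positivity) (fun z => norm_fluxJump_snd_le hCf hb (hu'M z))
    (g := fun _ => 1) contDiff_const (fun _ => zero_le_one) (by simp) ?_
  · filter_upwards [key, huu'] with p h1 h2
    rw [h2]
    have h3 := h1.resolve_left one_ne_zero
    rw [fluxJump_spaceTimeFlux] at h3
    have h4 := le_max_left (b - u' p) 0
    simp only at h3
    linarith
  · intro φ hφ
    simp only [mul_one]
    have h1 := hu.nonneg_minus b hφ
    have h2 : ∫ p, φ p * omegaMinus f Ω p.2 b (ub p.1 p.2) ∂(lateralMeasure Ω) = 0 := by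
      refine integral_eq_zero_of_ae ?_
      filter_upwards [hub] with p hp
      simp [omegaMinus_eq_zero f Ω p.2 hp]
    have h3 : ∫ x in Ω, max (b - u₀ x) 0 * φ (0, x) = 0 := by
      refine integral_eq_zero_of_ae ?_
      filter_upwards [hu₀] with x hx
      simp [hx]
    rw [h2, h3, add_zero, add_zero] at h1
    refine h1.trans_eq (integral_congr_ae ?_)
    filter_upwards [huu'] with p hp
    rw [hp]

end FiniteSpeed

/-! ### Transport along `w` and replacement of the initial data -/

section Replacement

variable {d : ℕ}

/-- Mean value inequality. Only the open interval has to lie in `I`, since the solutions may take an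
end point of `I` that is not in `I`. -/
theorem mul_sub_le_inner_of_speed {f : ℝ → Space d} (hf : ContDiff ℝ 1 f) {I : Set ℝ} {w : Space d}
    {c : ℝ} (hspeed : ∀ s ∈ I, c ≤ inner ℝ (deriv f s) w) {a b : ℝ} (hab : b ≤ a)
    (hI : Ioo b a ⊆ I) : c * (a - b) ≤ inner ℝ w (f a - f b) := by
  have hd : ∀ s, HasDerivAt (fun s => (inner ℝ w (f s) : ℝ)) (inner ℝ w (deriv f s)) s := by
    intro s
    have := (hasDerivAt_const s w).inner ℝ (hf.differentiable (by simp) s).hasDerivAt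
    simpa using this
  have := (convex_Icc b a).mul_sub_le_image_sub_of_le_deriv (f := fun s => (inner ℝ w (f s) : ℝ))
    (fun s _ => (hd s).continuousAt.continuousWithinAt)
    (fun s _ => (hd s).differentiableAt.differentiableWithinAt) (C := c) (fun s hs => by
      rw [interior_Icc] at hs
      rw [(hd s).deriv, real_inner_comm]
      exact hspeed s (hI hs)) b ⟨le_rfl, hab⟩ a ⟨hab, le_rfl⟩ hab
  rwa [inner_sub_right]

/-- A weight decreasing along the flow, and vanishing where the boundary data upstream have not
yet replaced the initial data. -/
noncomputable def sweepWeight (w : Space d) (c m δ : ℝ) (p : ℝ × Space d) : ℝ :=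
  Real.smoothTransition (2 * c / δ * p.1 - 1) * expNegInvGlue (m - δ - inner ℝ w p.2 + c * p.1)

theorem contDiff_sweepWeight (w : Space d) (c m δ : ℝ) : ContDiff ℝ ∞ (sweepWeight w c m δ) := by
  have h1 : ContDiff ℝ ∞ fun p : ℝ × Space d => Real.smoothTransition (2 * c / δ * p.1 - 1) :=
    (Real.smoothTransition.contDiff (n := ⊤)).comp
      ((contDiff_const.mul contDiff_fst).sub contDiff_const)
  have h2 : ContDiff ℝ ∞ fun p : ℝ × Space d =>
      expNegInvGlue (m - δ - inner ℝ w p.2 + c * p.1) :=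
    (expNegInvGlue.contDiff (n := ⊤)).comp
      ((contDiff_const.sub (contDiff_const.inner ℝ contDiff_snd)).add
        (contDiff_const.mul contDiff_fst))
  exact h1.mul h2

theorem sweepWeight_nonneg (w : Space d) (c m δ : ℝ) (p : ℝ × Space d) :
    0 ≤ sweepWeight w c m δ p :=
  mul_nonneg (Real.smoothTransition.nonneg _) (expNegInvGlue.nonneg _)

/-- This is the purpose of the first factor: the second vanishes for `c t ≤ δ` only where `⟨w,x⟩ ≥
m`, whereas the support is taken in all of space. -/
theorem tsupport_sweepWeight_subset (w : Space d) {c m δ : ℝ} (hc : 0 < c) (hδ : 0 < δ) :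
    tsupport (sweepWeight w c m δ) ⊆ {p | 0 < p.1} := by
  have h1 : tsupport (sweepWeight w c m δ) ⊆ {p | δ / (2 * c) ≤ p.1} := by
    refine closure_minimal (fun p hp => ?_) (isClosed_le continuous_const continuous_fst)
    have := left_ne_zero_of_mul hp
    rw [Ne, Real.smoothTransition.zero_iff_nonpos, not_le, sub_pos, div_mul_eq_mul_div,
      lt_div_iff₀ hδ, one_mul] at this
    change δ / (2 * c) ≤ p.1
    rw [div_le_iff₀ (by positivity)]
    linarith
  intro p hp
  exact lt_of_lt_of_le (by positivity : 0 < δ / (2 * c)) (h1 hp)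

theorem sweepWeight_pos (w : Space d) {c m δ : ℝ} (hδ : 0 < δ) {p : ℝ × Space d}
    (h1 : δ < c * p.1) (h2 : inner ℝ w p.2 - m + δ < c * p.1) : 0 < sweepWeight w c m δ p := by
  refine mul_pos (Real.smoothTransition.pos_of_pos ?_) (expNegInvGlue.pos_of_pos (by linarith))
  rw [sub_pos, div_mul_eq_mul_div, lt_div_iff₀ hδ]
  linarith

/-- Where `⟨w,x⟩ ≥ m`, the second factor vanishes unless `c t > δ`, and there the transition is
locally constant, so its derivative never contributes. What remains has the sign of `c V.1 - ⟨w,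
V.2⟩`. -/
theorem fderiv_sweepWeight_nonpos (w : Space d) {c m δ : ℝ} (hδ : 0 < δ)
    {p V : ℝ × Space d} (hp : m ≤ inner ℝ w p.2) (hV : c * V.1 ≤ inner ℝ w V.2) :
    fderiv ℝ (sweepWeight w c m δ) p V ≤ 0 := by
  set q := m - δ - inner ℝ w p.2 + c * p.1 with hq
  set θ := 2 * c / δ * p.1 - 1 with hθ
  have htime : HasDerivAt (fun s : ℝ => p.1 + s * V.1) V.1 0 := by
    simpa using ((hasDerivAt_id (0 : ℝ)).mul_const V.1).const_add p.1
  have hspace : HasDerivAt (fun s : ℝ => (inner ℝ w (p.2 + s • V.2) : ℝ)) (inner ℝ w V.2) 0 := by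
    have : (fun s : ℝ => (inner ℝ w (p.2 + s • V.2) : ℝ))
        = fun s => inner ℝ w p.2 + s * inner ℝ w V.2 := by
      ext s
      rw [inner_add_right, inner_smul_right]
    rw [this]
    simpa using ((hasDerivAt_id (0 : ℝ)).mul_const (inner ℝ w V.2 : ℝ)).const_add
      (inner ℝ w p.2 : ℝ)
  have hglue : HasDerivAt (fun s : ℝ => expNegInvGlue
      (m - δ - inner ℝ w (p.2 + s • V.2) + c * (p.1 + s * V.1)))
      (deriv expNegInvGlue q * (-inner ℝ w V.2 + c * V.1)) 0 := by
    have h1 := (hspace.const_sub (m - δ)).add (htime.const_mul c)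
    refine HasDerivAt.comp (0 : ℝ) (h₂ := expNegInvGlue) ?_ h1
    simpa [hq] using hasDerivAt_expNegInvGlue q
  have htrans : HasDerivAt
      (fun s : ℝ => Real.smoothTransition (2 * c / δ * (p.1 + s * V.1) - 1))
      (deriv Real.smoothTransition θ * (2 * c / δ * V.1)) 0 := by
    have h1 := (htime.const_mul (2 * c / δ)).sub_const 1
    refine HasDerivAt.comp (0 : ℝ) (h₂ := Real.smoothTransition) ?_ h1
    have h2 : HasDerivAt Real.smoothTransition (deriv Real.smoothTransition θ) θ :=
      ((Real.smoothTransition.contDiff (n := 1)).differentiable (by simp) θ).hasDerivAt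
    simpa [hθ] using h2
  have hline : HasDerivAt (fun s : ℝ => sweepWeight w c m δ (p + s • V))
      (deriv Real.smoothTransition θ * (2 * c / δ * V.1) * expNegInvGlue q
        + Real.smoothTransition θ * (deriv expNegInvGlue q * (-inner ℝ w V.2 + c * V.1))) 0 := by
    have h1 := htrans.fun_mul hglue
    simp only [zero_mul, zero_smul, add_zero, ← hq, ← hθ] at h1
    exact h1
  rw [fderiv_apply_of_hasDerivAt_line
    ((contDiff_sweepWeight w c m δ).differentiable (by simp) p) hline]
  have h1 : deriv Real.smoothTransition θ * (2 * c / δ * V.1) * expNegInvGlue q = 0 := by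
    rcases le_or_gt (c * p.1) δ with h | h
    · rw [expNegInvGlue.zero_of_nonpos (by linarith), mul_zero]
    · have hθ1 : 1 < θ := by
        have : 2 < 2 * c / δ * p.1 := by
          rw [div_mul_eq_mul_div, lt_div_iff₀ hδ]
          linarith
        linarith
      have : Real.smoothTransition =ᶠ[𝓝 θ] fun _ => 1 := by
        filter_upwards [lt_mem_nhds hθ1] with s hs
        exact Real.smoothTransition.one_of_one_le hs.le
      rw [this.deriv_eq, deriv_const, zero_mul, zero_mul]
  rw [h1, zero_add]
  exact mul_nonpos_of_nonneg_of_nonpos (Real.smoothTransition.nonneg _)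
    (mul_nonpos_of_nonneg_of_nonpos (deriv_expNegInvGlue_nonneg q) (by linarith))

/-- If the data take values in `I`, then so does the solution, up to the end points of `I`. -/
theorem IsEntropySolution.ae_between {f : ℝ → Space d} (hf : ContDiff ℝ 1 f) {Ω : Set (Space d)}
    (hΩ : IsOpen Ω) {u₀ : Space d → ℝ} {ub u : ℝ → Space d → ℝ}
    (hu : IsEntropySolution f Ω u₀ ub u) {I : Set ℝ} (hI : I.Nonempty)
    (hu₀ : ∀ᵐ x ∂(volume.restrict Ω), u₀ x ∈ I)
    (hub : ∀ᵐ p ∂(lateralMeasure Ω), ub p.1 p.2 ∈ I) :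
    ∀ᵐ p ∂(cylinderMeasure Ω),
      (∀ s < u p.1 p.2, ∃ i ∈ I, s < i) ∧ ∀ s > u p.1 p.2, ∃ i ∈ I, i < s := by
  have h1 : ∀ᵐ p ∂(cylinderMeasure Ω), ∀ s < u p.1 p.2, ∃ i ∈ I, s < i := by
    -- If `I` is unbounded above there is nothing to prove; otherwise the maximum principle applies
    -- with `b = sSup I`.
    by_cases hb : BddAbove I
    · filter_upwards [hu.ae_le hf hΩ (hu₀.mono fun x hx => le_csSup hb hx)
        (hub.mono fun p hp => le_csSup hb hp)] with p hp s hs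
      exact exists_lt_of_lt_csSup hI (hs.trans_le hp)
    · exact Eventually.of_forall fun p s _ => not_bddAbove_iff.1 hb s
  have h2 : ∀ᵐ p ∂(cylinderMeasure Ω), ∀ s > u p.1 p.2, ∃ i ∈ I, i < s := by
    by_cases hb : BddBelow I
    · filter_upwards [hu.ae_ge hf hΩ (hu₀.mono fun x hx => csInf_le hb hx)
        (hub.mono fun p hp => csInf_le hb hp)] with p hp s hs
      exact exists_lt_of_csInf_lt hI (hp.trans_lt hs)
    · exact Eventually.of_forall fun p s _ => not_bddBelow_iff.1 hb s
  exact h1.and h2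

/-- Comparison of two entropy solutions with the same boundary datum in the region already swept
by the flow in the direction `w`. -/
theorem IsEntropySolution.ae_le_of_swept (hd : 1 ≤ d) {f : ℝ → Space d} (hf : ContDiff ℝ 1 f)
    {Ω : Set (Space d)} (hΩ : IsC2Domain Ω) {I : Set ℝ} (hI : I.OrdConnected) (hIne : I.Nonempty)
    {w : Space d} {c : ℝ} (hc : 0 < c) (hspeed : ∀ s ∈ I, c ≤ inner ℝ (deriv f s) w) {m : ℝ}
    (hm : ∀ x ∈ Ω, m ≤ inner ℝ w x) {u₀ v₀ : Space d → ℝ} {ub : ℝ → Space d → ℝ}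
    (hub : MemLp (fun p : ℝ × Space d => ub p.1 p.2) ⊤ (lateralMeasure Ω))
    (hu₀I : ∀ᵐ x ∂(volume.restrict Ω), u₀ x ∈ I)
    (hv₀I : ∀ᵐ x ∂(volume.restrict Ω), v₀ x ∈ I)
    (hubI : ∀ᵐ p ∂(lateralMeasure Ω), ub p.1 p.2 ∈ I)
    {u v : ℝ → Space d → ℝ} (hu : IsEntropySolution f Ω u₀ ub u)
    (hv : IsEntropySolution f Ω v₀ ub v) :
    ∀ᵐ p ∂(cylinderMeasure Ω), inner ℝ w p.2 - m < c * p.1 → u p.1 p.2 ≤ v p.1 p.2 := by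
  obtain ⟨M₁, hM₁⟩ := exists_measurable_representative hu.memLp
  obtain ⟨M₂, hM₂⟩ := exists_measurable_representative hv.memLp
  set M := max M₁ M₂
  obtain ⟨u', hu'm, hu'M, huu'⟩ := hM₁ M (le_max_left _ _)
  obtain ⟨v', hv'm, hv'M, hvv'⟩ := hM₂ M (le_max_right _ _)
  obtain ⟨C, hCf, hCG⟩ := exists_lipschitzOnWith_spaceTimeFlux hf M
  have hJ := continuous_fluxJump (continuous_spaceTimeFlux hf.continuous)
  have hQm : MeasurableSet (Ioi (0 : ℝ) ×ˢ Ω) := measurableSet_Ioi.prod hΩ.1.measurableSet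
  have hQ : ∀ᵐ p ∂(cylinderMeasure Ω), p ∈ Ioi (0 : ℝ) ×ˢ Ω := ae_restrict_mem hQm
  have hflow : ∀ᵐ p ∂(cylinderMeasure Ω), c * (fluxJump (spaceTimeFlux f) (u' p) (v' p)).1
      ≤ inner ℝ w (fluxJump (spaceTimeFlux f) (u' p) (v' p)).2 := by
    filter_upwards [huu', hvv', hu.ae_between hf hΩ.1 hIne hu₀I hubI,
      hv.ae_between hf hΩ.1 hIne hv₀I hubI] with p h1 h2 h3 h4
    rw [h1] at h3
    rw [h2] at h4
    rw [fluxJump_spaceTimeFlux]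
    rcases lt_or_ge (v' p) (u' p) with h | h
    · simp only [h, if_true, max_eq_left (sub_nonneg.2 h.le)]
      -- A value strictly between `v'` and `u'` lies between two elements of `I`, hence in `I` by
      -- order-connectedness.
      refine mul_sub_le_inner_of_speed hf hspeed h.le fun s hs => ?_
      obtain ⟨i, hi, his⟩ := h3.1 s hs.2
      obtain ⟨j, hj, hjs⟩ := h4.2 s hs.1
      exact hI.out hj hi ⟨hjs.le, his.le⟩
    · simp [not_lt.2 h, max_eq_right (sub_nonpos.2 h)]
  -- The positivity sets of the weights with `δ = 1 / (n + 1)` exhaust the swept region inside the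
  -- cylinder.
  have hδ : ∀ n : ℕ, ∀ᵐ p ∂(cylinderMeasure Ω),
      sweepWeight w c m (1 / (n + 1)) p = 0 ∨ (fluxJump (spaceTimeFlux f) (u' p) (v' p)).1 = 0 := by
    intro n
    have hδ0 : (0 : ℝ) < 1 / (n + 1) := by positivity
    refine ae_eq_zero_of_weak_inequality hΩ.1
      (V := fun z => fluxJump (spaceTimeFlux f) (u' z) (v' z))
      (hJ.measurable.comp (hu'm.prodMk hv'm)) (B := 2 * C * (2 * M)) (fun z => by
        refine (norm_fluxJump_le hCG (hu'M z) (hv'M z)).trans ?_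
        have : |v' z - u' z| ≤ 2 * M := by
          rw [abs_le]
          constructor <;> linarith [(hu'M z).1, (hu'M z).2, (hv'M z).1, (hv'M z).2]
        gcongr)
      (C := C + 1) (by positivity) (fun z => norm_fluxJump_snd_le hCf (hu'M z) (hv'M z))
      (contDiff_sweepWeight w c m _) (sweepWeight_nonneg w c m _) ?_ fun φ hφ => ?_
    · filter_upwards [hflow, hQ] with p h1 h2
      exact fderiv_sweepWeight_nonpos w hδ0 (hm _ h2.2) h1
    · have h1 := hu.kato hd hf hΩ hub hv
        (hφ.mul (contDiff_sweepWeight w c m (1 / (n + 1))) (sweepWeight_nonneg w c m _))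
        ((tsupport_mul_subset_right' _ _).trans (tsupport_sweepWeight_subset w hc hδ0))
      refine h1.trans_eq (integral_congr_ae ?_)
      filter_upwards [huu', hvv'] with p hp1 hp2
      rw [hp1, hp2]
  filter_upwards [ae_all_iff.2 hδ, huu', hvv', hQ] with p h1 h2 h3 h4 hlt
  obtain ⟨n, hn⟩ := exists_nat_one_div_lt (sub_pos.2 hlt)
  have h5 := hm p.2 h4.2
  have h6 : 0 < sweepWeight w c m (1 / (n + 1)) p :=
    sweepWeight_pos w (by positivity) (by linarith) (by linarith)
  have h7 := (h1 n).resolve_left h6.ne'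
  rw [fluxJump_spaceTimeFlux] at h7
  rw [h2, h3]
  have h8 := le_max_left (u' p - v' p) 0
  simp only at h7
  linarith

/-- Two families that are continuous in `L¹_loc` and coincide at almost every time from `T` on
coincide at every time from `T` on. -/
theorem ContinuousInL1loc.ae_eq {Ω : Set (Space d)} (hΩ : IsOpen Ω) {u v : ℝ → Space d → ℝ}
    (hu : ContinuousInL1loc Ω u) (hv : ContinuousInL1loc Ω v) {T : ℝ} (hT : 0 < T)
    (huv : ∀ᵐ t ∂(volume.restrict (Ici T)), ∀ᵐ x ∂(volume.restrict Ω), u t x = v t x) {t : ℝ}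
    (ht : T ≤ t) : ∀ᵐ x ∂(volume.restrict Ω), u t x = v t x := by
  have ht0 : 0 < t := hT.trans_le ht
  -- Times are approached from the right because coincidence is known only from `T` on, and `t = T`
  -- is allowed.
  have hfreq : ∃ᶠ s in 𝓝[>] t, ∀ᵐ x ∂(volume.restrict Ω), u s x = v s x := by
    intro hev
    obtain ⟨b, hb, hsub⟩ := mem_nhdsGT_iff_exists_Ioo_subset.1 hev
    have h1 : volume (Ioo t b) = 0 := by
      have h2 : Ioo t b ⊆ Ici T := fun s hs => ht.trans hs.1.le
      have h3 : volume.restrict (Ici T) (Ioo t b) = 0 := measure_mono_null hsub huv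
      rwa [Measure.restrict_apply measurableSet_Ioo, inter_eq_left.2 h2] at h3
    rw [Real.volume_Ioo, ENNReal.ofReal_eq_zero] at h1
    exact absurd (mem_Ioi.1 hb) (not_lt.2 (by linarith))
  have hcompact : ∀ K, IsCompact K → K ⊆ Ω → ∀ᵐ x ∂(volume.restrict K), u t x = v t x := by
    intro K hK hKΩ
    have hut := hu t ht0 K hK hKΩ
    have hvt := hv t ht0 K hK hKΩ
    have hzero : ∫⁻ x in K, ‖u t x - v t x‖ₑ = 0 := by
      refine le_antisymm (ENNReal.le_of_forall_pos_le_add fun ε hε _ => ?_) bot_le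
      have hε2 : (0 : ENNReal) < ε / 2 := ENNReal.half_pos (by exact_mod_cast hε.ne')
      have e1 : ∀ᶠ s in 𝓝[>] t, ∫⁻ x in K, ‖u s x - u t x‖ₑ < ε / 2 :=
        (hut.2.mono_left nhdsWithin_le_nhds).eventually (gt_mem_nhds hε2)
      have e2 : ∀ᶠ s in 𝓝[>] t, ∫⁻ x in K, ‖v s x - v t x‖ₑ < ε / 2 :=
        (hvt.2.mono_left nhdsWithin_le_nhds).eventually (gt_mem_nhds hε2)
      obtain ⟨s, hs, h1, h2, h3⟩ :=
        (hfreq.and_eventually (e1.and (e2.and self_mem_nhdsWithin))).exists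
      have hs' : ∀ᵐ x ∂(volume.restrict K), u s x = v s x :=
        ae_mono (Measure.restrict_mono hKΩ le_rfl) hs
      have hmeas : AEMeasurable (fun x => ‖u s x - u t x‖ₑ) (volume.restrict K) :=
        ((hu s (ht0.trans h3) K hK hKΩ).1.aestronglyMeasurable.sub
          hut.1.aestronglyMeasurable).enorm
      calc ∫⁻ x in K, ‖u t x - v t x‖ₑ
          ≤ ∫⁻ x in K, (‖u s x - u t x‖ₑ + ‖v s x - v t x‖ₑ) := by
            refine lintegral_mono_ae ?_
            filter_upwards [hs'] with x hx
            have : u t x - v t x = -(u s x - u t x) + (v s x - v t x) := by rw [hx]; ring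
            rw [this]
            refine (enorm_add_le _ _).trans ?_
            rw [enorm_neg]
        _ = (∫⁻ x in K, ‖u s x - u t x‖ₑ) + ∫⁻ x in K, ‖v s x - v t x‖ₑ :=
            lintegral_add_left' hmeas _
        _ ≤ ε / 2 + ε / 2 := add_le_add h1.le h2.le
        _ = 0 + ε := by rw [ENNReal.add_halves, zero_add]
    have hmeas : AEMeasurable (fun x => ‖u t x - v t x‖ₑ) (volume.restrict K) :=
      (hut.1.aestronglyMeasurable.sub hvt.1.aestronglyMeasurable).enorm
    rw [lintegral_eq_zero_iff' hmeas] at hzero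
    filter_upwards [hzero] with x hx
    simpa [sub_eq_zero] using hx
  -- Equality on compact subsets passes to `Ω` because every point has a closed ball inside `Ω`.
  rw [ae_restrict_iff' hΩ.measurableSet, ae_iff]
  refine measure_null_of_locally_null _ fun x hx => ?_
  simp only [mem_ofPred_eq, Classical.not_imp] at hx
  obtain ⟨r, hr, hrΩ⟩ := Metric.nhds_basis_closedBall.mem_iff.1 (hΩ.mem_nhds hx.1)
  refine ⟨{y | ¬(y ∈ Ω → u t y = v t y)} ∩ Metric.closedBall x r,
    inter_mem self_mem_nhdsWithin (mem_nhdsWithin_of_mem_nhds (Metric.closedBall_mem_nhds x hr)),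
    ?_⟩
  have h1 := hcompact _ (isCompact_closedBall x r) hrΩ
  rw [ae_restrict_iff' Metric.isClosed_closedBall.measurableSet, ae_iff] at h1
  refine measure_mono_null (fun y hy => ?_) h1
  simp only [mem_inter_iff, mem_ofPred_eq, Classical.not_imp] at hy ⊢
  exact ⟨hy.2, hy.1.2⟩

end Replacement

theorem proposition1 {d : ℕ} (hd : 1 ≤ d)
    (f : ℝ → Space d) (hf : ContDiff ℝ 1 f)
    (Ω : Set (Space d)) (hΩ : IsC2Domain Ω)
    (I : Set ℝ) (hI : I.OrdConnected)
    (w : Space d) (c 𝔱 : ℝ) (hrep : ReplacementCondition f Ω I w c 𝔱)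
    (u₀ v₀ : Space d → ℝ) (ub : ℝ → Space d → ℝ)
    (hu₀ : MemLp u₀ ⊤ (volume.restrict Ω)) (hv₀ : MemLp v₀ ⊤ (volume.restrict Ω))
    (hub : MemLp (fun p : ℝ × Space d => ub p.1 p.2) ⊤ (lateralMeasure Ω))
    (hu₀I : ∀ᵐ x ∂(volume.restrict Ω), u₀ x ∈ I)
    (hv₀I : ∀ᵐ x ∂(volume.restrict Ω), v₀ x ∈ I)
    (hubI : ∀ᵐ p ∂(lateralMeasure Ω), ub p.1 p.2 ∈ I)
    (u v : ℝ → Space d → ℝ)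
    (hu : IsEntropySolution f Ω u₀ ub u) (hv : IsEntropySolution f Ω v₀ ub v) :
    (∀ᵐ t ∂(volume.restrict (Ici 𝔱)), ∀ᵐ x ∂(volume.restrict Ω), u t x = v t x) ∧
    (ContinuousInL1loc Ω u → ContinuousInL1loc Ω v →
      ∀ t : ℝ, 𝔱 ≤ t → ∀ᵐ x ∂(volume.restrict Ω), u t x = v t x) := by
  have hmain : ∀ᵐ t ∂(volume.restrict (Ici 𝔱)), ∀ᵐ x ∂(volume.restrict Ω), u t x = v t x := by
    -- If `I` is empty, the assumption on `u₀` makes `Ω` a null set.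
    rcases I.eq_empty_or_nonempty with rfl | hIne
    · have : ∀ᵐ x ∂(volume.restrict Ω), False := by simpa using hu₀I
      exact Eventually.of_forall fun t => this.mono fun x hx => hx.elim
    set m := sInf ((fun x : Space d => (inner ℝ w x : ℝ)) '' Ω) with hm_def
    have hm : ∀ x ∈ Ω, m ≤ inner ℝ w x := fun x hx =>
      csInf_le hrep.bddBelow (mem_image_of_mem _ hx)
    have h1 := hu.ae_le_of_swept hd hf hΩ hI hIne hrep.c_pos hrep.speed hm hub hu₀I hv₀I hubI hv
    have h2 := hv.ae_le_of_swept hd hf hΩ hI hIne hrep.c_pos hrep.speed hm hub hv₀I hu₀I hubI hu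
    have h3 : ∀ᵐ p ∂((volume.restrict (Ioi (0 : ℝ))).prod (volume.restrict Ω)),
        inner ℝ w p.2 - m < c * p.1 → u p.1 p.2 = v p.1 p.2 := by
      rw [Measure.prod_restrict, ← Measure.volume_eq_prod]
      filter_upwards [h1, h2] with p hp1 hp2 hp
      exact le_antisymm (hp1 hp) (hp2 hp)
    have h4 := Measure.ae_ae_of_ae_prod h3
    have h5 : ∀ᵐ t ∂(volume.restrict (Ioi 𝔱)), ∀ᵐ x ∂(volume.restrict Ω),
        inner ℝ w x - m < c * t → u t x = v t x :=
      ae_mono (Measure.restrict_mono (Ioi_subset_Ioi hrep.time_pos.le) le_rfl) h4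
    -- The swept region is defined by a strict inequality, so the single time `t = 𝔱` is discarded;
    -- for `t > 𝔱`, `⟨w,x⟩ - m ≤ c 𝔱 < c t` on all of `Ω`.
    rw [← restrict_Ioi_eq_restrict_Ici]
    filter_upwards [h5, ae_restrict_mem measurableSet_Ioi] with t ht htT
    filter_upwards [ht, ae_restrict_mem hΩ.1.measurableSet] with x hx hxΩ
    refine hx ?_
    have h6 := le_csSup hrep.bddAbove (mem_image_of_mem _ hxΩ)
    have h7 := hrep.time_eq
    rw [eq_div_iff hrep.c_pos.ne'] at h7
    have h8 : c * 𝔱 < c * t := mul_lt_mul_of_pos_left htT hrep.c_pos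
    linarith
  exact ⟨hmain, fun hcu hcv t ht => hcu.ae_eq hΩ.1 hcv hrep.time_pos hmain ht⟩
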